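/- **Conventions.** A polygonal curve in $\mathbb{R}^d$ is given by a finite sequence of at least two vertices, contiguous vertices being joined by line segments (curves are considered up to reparameterization; repeated or collinear consecutive vertices are allowed). $|\tau|$ is the number of vertices of $\tau$, and $\mathbb{X}^d_k$ is the class of polygonal curves with at most $k$ vertices. The Fréchet distance is $d_F(\sigma,\tau)=\inf_h\max_{t\in[0,1]}\lVert\sigma(t)-\tau(h(t))\rVert$, where $h$ ranges over the continuous bijections of $[0,1]$ with $h(0)=0$, $h(1)=1$. For a finite set or multiset $T$ of curves let $\mathrm{cost}(T,c)=\sum_{\tau\in T}d_F(\tau,c)$. A curve $c$ is an $\alpha$-approximate $(1,\ell)$-median for $T$ if $\mathrm{cost}(T,c)\le\alpha\,\mathrm{cost}(T,c')$ for all $c'\in\mathbb{X}^d_\ell$ (the number of vertices of $c$ is bounded separately). For $r>0$ and $X\subseteq\mathbb{R}^d$ let $\mathbb{G}(X,r)=\{(\lfloor p_1/r\rfloor r,\dots,\lfloor p_d/r\rfloor r)\mid p\in X\}$; for $r = 0$ no grid points are generated. $B(p,r)$ is the closed Euclidean ball. Let $\ell\ge 2$, and let $\mathrm{simpl}$ be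 any fixed subroutine (a map) that computes $4$-approximate minimum-error $\ell$-simplifications: for every polygonal curve $\tau$, $\mathrm{simpl}(\tau)\in\mathbb{X}^d_\ell$ and $d_F(\tau,\mathrm{simpl}(\tau))\le 4\,d_F(\tau,\sigma)$ for all $\sigma\in\mathbb{X}^d_\ell$. **Algorithm 1** (input: a finite multiset $A$ of curves, $\delta_1\in(0,1)$). Draw a sample $S$ of $\lceil 2(\ln 2-\ln\delta_1)\rceil$ curves and a sample $W$ of $\lceil -64(\ln\delta_1-\ln\lceil 4\ln 2-\ln\delta_1\rceil)\rceil$ curves from $A$, uniformly and independently with replacement; return a curve from $\{\mathrm{simpl}(s)\mid s\in S\}$ that minimizes $\mathrm{cost}(W,\cdot)$. **Algorithm 2** (input: a finite non-empty set $T$ of $n$ polygonal curves, and $\beta,\delta,\varepsilon$). Put $\varepsilon'=\varepsilon/3$ and $C=\emptyset$. Draw a sample $S$ of $\lceil -8\beta(\varepsilon')^{-1}(\ln\delta-\ln 4)\rceil$ curves from $T$ uniformly and independently with replacement. For each sub-multiset $S'$ of $S$ (a set of positions in the sample) with $|S'|=\lceil |S|/(2\beta)\rceil$: let $c$ be the result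 of Algorithm 1 on $(S',\delta/4)$, run with fresh independent randomness; let $\Delta=\mathrm{cost}(S',c)$, $\Delta_l=\frac{\delta n}{2|S|}\cdot\frac{\Delta}{34}$, $\Delta_u=\Delta/\varepsilon'$; add $c$ to $C$; and for each $s\in S'$ with vertices $v^s_1,\dots,v^s_{|s|}$ add to $C$ all polygonal curves with $2\ell-2$ vertices from $P=\bigcup_{i}\mathbb{G}\bigl(B(v^s_i,(1+\varepsilon')\Delta_u),\tfrac{2\varepsilon'}{n\sqrt d}\Delta_l\bigr)$. Return $C$. **Theorem.** Let $\beta\in[1,\infty)$, $\delta,\varepsilon\in(0,1)$, and let $T\subset\mathbb{X}^d_m$ be a finite non-empty set of polygonal curves. For every $T'\subseteq T$ with $|T'|\ge\frac1\beta|T|$, with probability at least $1-\delta$ (over the random choices of Algorithm 2, and no matter how ties in the minimizations are broken) the set $C$ returned by Algorithm 2 on $(T,\beta,\delta,\varepsilon)$ contains a $(3+\varepsilon)$-approximate $(1,\ell)$-median for $T'$ with at most $2\ell-2$ vertices. -/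

import Mathlib

open MeasureTheory ProbabilityTheory

noncomputable section

/-- A polygonal curve in `ℝ^d`, given by its sequence of (at least two) vertices. A polygonal curve
up to reparameterization is determined by its vertex sequence. Repeated and collinear consecutive
vertices are permitted, so a curve of complexity at most `k` is one that can be written
with at most `k` vertices. -/
structure PolygonalCurve (d : ℕ) where
  edges : ℕ
  edges_pos : 0 < edges
  vertex : Fin (edges + 1) → EuclideanSpace ℝ (Fin d)

namespace PolygonalCurve

variable {d : ℕ}

/-- The number of vertices. -/
def complexity (τ : PolygonalCurve d) : ℕ := τ.edges + 1

/-- The parameterization of `τ` over `[0,1]` that visits vertex `i` at the instant `i / edges` and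
connects contiguous vertices by line segments (see `toCurve_segment`):
`τ(t) = v₀ + ∑ i, clamp (edges * t - i) • (v_{i+1} - v_i)`, where `clamp` truncates to `[0,1]`. -/
def toCurve (τ : PolygonalCurve d) : C(unitInterval, EuclideanSpace ℝ (Fin d)) where
  toFun t := τ.vertex 0 + ∑ i : Fin τ.edges,
    max 0 (min 1 ((τ.edges : ℝ) * t - (i : ℝ))) • (τ.vertex i.succ - τ.vertex i.castSucc)
  continuous_toFun := by fun_prop

theorem toCurve_segment (τ : PolygonalCurve d) (i : Fin τ.edges) (t : unitInterval) (s : ℝ)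
    (hs : s ∈ Set.Icc (0 : ℝ) 1) (ht : (τ.edges : ℝ) * t = i + s) :
    τ.toCurve t = (1 - s) • τ.vertex i.castSucc + s • τ.vertex i.succ := by
  have key : ∀ (n : ℕ) (v : Fin (n + 1) → EuclideanSpace ℝ (Fin d)) (i : Fin n),
      v 0 + ∑ j : Fin n, max 0 (min 1 ((i : ℝ) + s - (j : ℝ))) • (v j.succ - v j.castSucc)
        = (1 - s) • v i.castSucc + s • v i.succ := by
    intro n
    induction n with
    | zero => intro v i; exact i.elim0
    | succ n ih =>
      intro v i
      rw [Fin.sum_univ_succ]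
      refine Fin.cases ?_ (fun k => ?_) i
      · have h0 : ∀ j : Fin n, max 0 (min 1 (((0 : Fin (n + 1)) : ℕ) + s - ((j.succ : ℕ) : ℝ))) = 0 := by
          intro j
          apply max_eq_left
          apply (min_le_right _ _).trans
          have : (0 : ℝ) ≤ (j : ℝ) := Nat.cast_nonneg _
          have := hs.2
          push_cast [Fin.val_succ, Fin.val_zero]
          linarith
        simp only [h0, zero_smul, Finset.sum_const_zero, add_zero]
        have : max 0 (min 1 (((0 : Fin (n + 1)) : ℕ) + s - (((0 : Fin (n + 1)) : ℕ) : ℝ))) = s := by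
          simp [hs.1, hs.2]
        rw [this, Fin.castSucc_zero, smul_sub, sub_smul, one_smul]
        abel
      · have h1 : max 0 (min 1 ((k.succ : ℕ) + s - (((0 : Fin (n + 1)) : ℕ) : ℝ))) = 1 := by
          have : (0 : ℝ) ≤ (k : ℝ) := Nat.cast_nonneg _
          have := hs.1
          rw [min_eq_left, max_eq_right zero_le_one]
          push_cast [Fin.val_succ, Fin.val_zero]
          linarith
        have := ih (fun j => v j.succ) k
        rw [h1, one_smul, Fin.castSucc_zero, ← add_assoc, add_sub_cancel]
        rw [← Fin.succ_castSucc] at *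
        rw [← this]
        congr 1
        apply Finset.sum_congr rfl
        intro j _
        rw [← Fin.succ_castSucc]
        congr 3
        push_cast [Fin.val_succ]
        ring_nf
  have := key τ.edges τ.vertex i
  rw [← this, ← ht]
  rfl

end PolygonalCurve

/-- The continuous bijections of `[0,1]` that fix `0` and `1`. -/
def Reparameterization : Type :=
  {h : unitInterval → unitInterval // Continuous h ∧ Function.Bijective h ∧ h 0 = 0 ∧ h 1 = 1}

/-- The (continuous) Fréchet distance between curves. -/
def curveFrechetDist {d : ℕ} (γ τ : C(unitInterval, EuclideanSpace ℝ (Fin d))) : ℝ :=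
  ⨅ h : Reparameterization, ⨆ t : unitInterval, ‖γ t - τ (h.1 t)‖

/-- The Fréchet distance between polygonal curves. -/
def frechetDist {d : ℕ} (γ τ : PolygonalCurve d) : ℝ :=
  curveFrechetDist γ.toCurve τ.toCurve

/-- The cost `∑ i, d_F(A i, c)` of a center `c` for a finite family (a sample, possibly with
repetitions) of curves. -/
def sampleCost {d : ℕ} {ι : Type} [Fintype ι] (A : ι → PolygonalCurve d)
    (c : PolygonalCurve d) : ℝ :=
  ∑ i, frechetDist (A i) c

/-- The cost `∑ τ ∈ T, d_F(τ, c)` of a center `c` for a finite set of curves. -/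
def cost {d : ℕ} (T : Finset (PolygonalCurve d)) (c : PolygonalCurve d) : ℝ :=
  ∑ τ ∈ T, frechetDist τ c

/-- The cost of `c` for `T` is at most `α` times that of every center with at most `ℓ` vertices. The
complexity of `c` itself is not restricted here. -/
def IsApproxMedian {d : ℕ} (α : ℝ) (ℓ : ℕ) (T : Finset (PolygonalCurve d))
    (c : PolygonalCurve d) : Prop :=
  ∀ c' : PolygonalCurve d, c'.complexity ≤ ℓ → cost T c ≤ α * cost T c'

/-- `simpl` maps every polygonal curve to an `α`-approximate minimum-error `ℓ`-simplification. -/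
def IsSimplifier {d : ℕ} (α : ℝ) (ℓ : ℕ) (simpl : PolygonalCurve d → PolygonalCurve d) : Prop :=
  ∀ τ, (simpl τ).complexity ≤ ℓ ∧
    ∀ γ : PolygonalCurve d, γ.complexity ≤ ℓ → frechetDist τ (simpl τ) ≤ α * frechetDist τ γ

/-- The `r`-grid-point of `p`. -/
def gridPoint {d : ℕ} (r : ℝ) (p : EuclideanSpace ℝ (Fin d)) : EuclideanSpace ℝ (Fin d) :=
  WithLp.toLp 2 fun j => (⌊p j / r⌋ : ℝ) * r

/-- The grid of cell width `r > 0` that covers `X`. There is no grid of cell width `0`; the set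
is empty then. -/
def gridCover {d : ℕ} (X : Set (EuclideanSpace ℝ (Fin d))) (r : ℝ) :
    Set (EuclideanSpace ℝ (Fin d)) :=
  {q | 0 < r ∧ ∃ p ∈ X, q = gridPoint r p}

/-! ### The `(1,ℓ)`-median algorithm by simplification -/

/-- Size of the sample of curves to be simplified, for failure probability `δ`. -/
def median34SampleSize (δ : ℝ) : ℕ := ⌈2 * (Real.log 2 - Real.log δ)⌉₊

/-- Size of the sample `W` against which the simplified curves are evaluated. -/
def median34EvalSize (δ : ℝ) : ℕ :=
  ⌈-64 * (Real.log δ - Real.log (⌈4 * Real.log 2 - Real.log δ⌉₊ : ℝ))⌉₊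

/-- `c` is a possible return value of the algorithm on the input family `A`, when `S` and `W` are
the (indices of the) two samples drawn: `c` minimizes `cost(W, ·)` over `{simpl(A s) | s ∈ S}`.
More than one `c` qualifies only if there are ties. -/
def IsMedian34Output {d : ℕ} {ι : Type} {N₁ N₂ : ℕ}
    (simpl : PolygonalCurve d → PolygonalCurve d) (A : ι → PolygonalCurve d)
    (S : Fin N₁ → ι) (W : Fin N₂ → ι) (c : PolygonalCurve d) : Prop :=
  (∃ i, c = simpl (A (S i))) ∧
    ∀ i, sampleCost (fun j => A (W j)) c ≤ sampleCost (fun j => A (W j)) (simpl (A (S i)))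

/-! ### The `(1,ℓ)`-median algorithm for subsets by simple shortcutting

The parameter `ε` below is the one the algorithm is called with; it works with `ε' = ε / 3`. -/

/-- The size of the sample `S`. -/
def shortcutSampleSize (β δ ε : ℝ) : ℕ :=
  ⌈-8 * β * (ε / 3)⁻¹ * (Real.log δ - Real.log 4)⌉₊

/-- The size `|S| / (2β)`, rounded up, of the subsamples `S' ⊆ S`. -/
def shortcutSubsampleSize (β δ ε : ℝ) : ℕ :=
  ⌈(shortcutSampleSize β δ ε : ℝ) / (2 * β)⌉₊

/-- The subsamples `S' ⊆ S` of the prescribed size, as sets of positions in the sample `S`. -/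
abbrev Subsample (β δ ε : ℝ) : Type :=
  {J : Finset (Fin (shortcutSampleSize β δ ε)) // J.card = shortcutSubsampleSize β δ ε}

/-- All the random choices of one run on input `T`: the sample `S`, drawn with replacement, and for
each subsample `S'` the two samples, drawn with replacement from `S'`, of the call of the
simplification algorithm on `S'` with failure probability `δ / 4`. This is a finite type; under
the uniform distribution on it, all these draws are independent and uniform. -/
structure ShortcutRandomness {d : ℕ} (T : Finset (PolygonalCurve d)) (β δ ε : ℝ) : Type where
  S : Fin (shortcutSampleSize β δ ε) → T
  S₁ : (J : Subsample β δ ε) → Fin (median34SampleSize (δ / 4)) → J.1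
  W : (J : Subsample β δ ε) → Fin (median34EvalSize (δ / 4)) → J.1

instance {d : ℕ} (T : Finset (PolygonalCurve d)) (β δ ε : ℝ) :
    MeasurableSpace (ShortcutRandomness T β δ ε) := ⊤

namespace ShortcutRandomness

variable {d : ℕ} {T : Finset (PolygonalCurve d)} {β δ ε : ℝ}

/-- The curves of the subsample `S'` at the positions `J`. -/
def subsample (ω : ShortcutRandomness T β δ ε) (J : Subsample β δ ε) : J.1 → PolygonalCurve d :=
  fun i => (ω.S i.1).1

/-- For each subsample `S'`, `c` records a return value of the simplification algorithm on `S'`. -/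
def IsCallResult (ω : ShortcutRandomness T β δ ε) (simpl : PolygonalCurve d → PolygonalCurve d)
    (c : Subsample β δ ε → PolygonalCurve d) : Prop :=
  ∀ J, IsMedian34Output simpl (ω.subsample J) (ω.S₁ J) (ω.W J) (c J)

/-- `Δ = cost(S', c)`. -/
def Δ (ω : ShortcutRandomness T β δ ε) (J : Subsample β δ ε) (c : PolygonalCurve d) : ℝ :=
  sampleCost (ω.subsample J) c

/-- `Δ_l = (δ n / (2 |S|)) * (Δ / 34)`, where `n = |T|`. -/
def Δl (ω : ShortcutRandomness T β δ ε) (J : Subsample β δ ε) (c : PolygonalCurve d) : ℝ :=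
  δ * T.card / (2 * shortcutSampleSize β δ ε) * (ω.Δ J c / 34)

/-- `Δ_u = Δ / ε'`. -/
def Δu (ω : ShortcutRandomness T β δ ε) (J : Subsample β δ ε) (c : PolygonalCurve d) : ℝ :=
  1 / (ε / 3) * ω.Δ J c

/-- The union `P` of the grids that cover the balls around the vertices of the curve `s`. -/
def gridPoints (ω : ShortcutRandomness T β δ ε) (J : Subsample β δ ε) (c s : PolygonalCurve d) :
    Set (EuclideanSpace ℝ (Fin d)) :=
  ⋃ i, gridCover (Metric.closedBall (s.vertex i) ((1 + ε / 3) * ω.Δu J c))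
    (2 * (ε / 3) / (T.card * √(d : ℝ)) * ω.Δl J c)

/-- The returned set of candidates: for each subsample `S'` the curve `c` computed for `S'`, and
for each `s ∈ S'` all polygonal curves with `2ℓ - 2` vertices from the grids around the
vertices of `s`. -/
def candidates (ω : ShortcutRandomness T β δ ε) (ℓ : ℕ)
    (c : Subsample β δ ε → PolygonalCurve d) : Set (PolygonalCurve d) :=
  ⋃ J, ({c J} ∪ ⋃ i : J.1, {q | q.complexity = 2 * ℓ - 2 ∧
    ∀ j, q.vertex j ∈ ω.gridPoints J (c J) (ω.subsample J i)})

end ShortcutRandomness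

end

/-!
Fix a center `c₀` with at most `ℓ` vertices that is nearly optimal for `T'`, and let `μ > 0` be the
average distance of the curves of `T'` to `c₀`. (If the infimum of the costs is zero, then all curves
of `T'` and their simplifications have distance zero from each other, and the result of any call on
a subsample of curves of `T'` will do: `cost_simpl_eq_zero`.) Up to small probability, there are
enough positions in the sample `S` that hit `T'`. Choose a subsample `S'` among them by looking only
at which positions these are; then `S'` is a uniform sample of `T'` (`sum_hits_eq_prod`). By Markov's
inequality, it is likely that some `s ∈ S'` has distance at most `(1 + ε / 3) μ` from `c₀`, and that
the cost of `c₀` for `S'` does not exceed its expectation by more than a factor of order `1 / δ`.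
Moreover, the center `c` computed for `S'` is likely to be a 34-approximation for `S'`
(`uniformProb_isMedian34Output_le`).

The rest is deterministic (`ShortcutRandomness.exists_mem_candidates`). If `c` is at distance at most
about `(2 + ε) μ` from `c₀`, then `c` itself is good enough by the triangle inequality. Otherwise `s`
has distance more than `μ` from `c`, so that `Δ > μ` and the balls around the vertices of `s` are
large enough to contain the vertices of the curve obtained by shortcutting `c₀` along `s`
(`exists_shortcut`). This curve has `2ℓ - 2` vertices and distance at most about `2 (1 + ε / 3) μ`
from `c₀`. Rounding its vertices to the grid moves it by at most `(2 ε / (3 n)) Δ_l`, which is at most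
about `(ε / 3) μ` by the bounds on the cost of `c₀` and of `c` for `S'`. The total is below
`(2 + ε) μ` by a margin that pays for `c₀` not being exactly optimal.

The only probability space is a finite set under the uniform distribution, so probabilities and
expectations are handled as averages `𝔼` over finite types.
-/

/-! ### The Fréchet distance -/

namespace Reparameterization

theorem strictMono (h : Reparameterization) : StrictMono h.1 :=
  h.2.1.strictMono_of_inj_boundedOrder (by
    have h0 := h.2.2.2.1
    have : h.1 ⊥ = 0 := h0
    rw [this]; exact bot_le) h.2.2.1.1

/-- The inverse of a reparameterization; it is continuous because `[0,1]` is compact. -/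
noncomputable def symm (h : Reparameterization) : Reparameterization :=
  let e := Equiv.ofBijective h.1 h.2.2.1
  ⟨e.symm, (Continuous.homeoOfEquivCompactToT2 (f := e) h.2.1).symm.continuous, e.symm.bijective,
    by rw [Equiv.symm_apply_eq]; exact h.2.2.2.1.symm,
    by rw [Equiv.symm_apply_eq]; exact h.2.2.2.2.symm⟩

theorem apply_symm_apply (h : Reparameterization) (t : unitInterval) : h.1 (h.symm.1 t) = t :=
  (Equiv.ofBijective h.1 h.2.2.1).apply_symm_apply t

theorem symm_apply_apply (h : Reparameterization) (t : unitInterval) : h.symm.1 (h.1 t) = t :=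
  (Equiv.ofBijective h.1 h.2.2.1).symm_apply_apply t

/-- `t ↦ g (h t)`. -/
noncomputable def comp (g h : Reparameterization) : Reparameterization :=
  ⟨g.1 ∘ h.1, g.2.1.comp h.2.1, g.2.2.1.comp h.2.2.1, by simp [h.2.2.2.1, g.2.2.2.1],
    by simp [h.2.2.2.2, g.2.2.2.2]⟩

instance : Inhabited Reparameterization :=
  ⟨⟨id, continuous_id, Function.bijective_id, rfl, rfl⟩⟩

end Reparameterization

section Curves

variable {d : ℕ} {γ τ ρ : C(unitInterval, EuclideanSpace ℝ (Fin d))}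

theorem bddAbove_range_norm_sub (γ τ : C(unitInterval, EuclideanSpace ℝ (Fin d)))
    (h : Reparameterization) : BddAbove (Set.range fun t => ‖γ t - τ (h.1 t)‖) := by
  refine (isCompact_range ?_).bddAbove
  have := h.2.1
  fun_prop

theorem bddBelow_range_iSup_norm_sub (γ τ : C(unitInterval, EuclideanSpace ℝ (Fin d))) :
    BddBelow (Set.range fun h : Reparameterization => ⨆ t : unitInterval, ‖γ t - τ (h.1 t)‖) :=
  ⟨0, by rintro _ ⟨h, rfl⟩; exact Real.iSup_nonneg fun t => norm_nonneg _⟩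

theorem curveFrechetDist_le {r : ℝ} (h : Reparameterization)
    (hr : ∀ t, ‖γ t - τ (h.1 t)‖ ≤ r) : curveFrechetDist γ τ ≤ r :=
  (ciInf_le (bddBelow_range_iSup_norm_sub γ τ) h).trans (ciSup_le hr)

theorem exists_reparameterization_of_curveFrechetDist_lt {r : ℝ} (hr : curveFrechetDist γ τ < r) :
    ∃ h : Reparameterization, ∀ t, ‖γ t - τ (h.1 t)‖ ≤ r := by
  obtain ⟨h, hh⟩ := exists_lt_of_ciInf_lt hr
  exact ⟨h, fun t => (le_ciSup (bddAbove_range_norm_sub γ τ h) t).trans hh.le⟩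

theorem curveFrechetDist_nonneg : 0 ≤ curveFrechetDist γ τ :=
  Real.iInf_nonneg fun _ => Real.iSup_nonneg fun _ => norm_nonneg _

theorem curveFrechetDist_comm : curveFrechetDist γ τ = curveFrechetDist τ γ := by
  have key : ∀ γ τ : C(unitInterval, EuclideanSpace ℝ (Fin d)),
      curveFrechetDist γ τ ≤ curveFrechetDist τ γ := fun γ τ => by
    refine le_of_forall_gt_imp_ge_of_dense fun r hr => ?_
    obtain ⟨h, hh⟩ := exists_reparameterization_of_curveFrechetDist_lt hr
    refine curveFrechetDist_le h.symm fun t => ?_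
    rw [norm_sub_rev]
    simpa [h.apply_symm_apply] using hh (h.symm.1 t)
  exact le_antisymm (key _ _) (key _ _)

theorem curveFrechetDist_triangle :
    curveFrechetDist γ ρ ≤ curveFrechetDist γ τ + curveFrechetDist τ ρ := by
  refine le_of_forall_pos_le_add fun η hη => ?_
  obtain ⟨g, hg⟩ := exists_reparameterization_of_curveFrechetDist_lt
    (lt_add_of_pos_right (curveFrechetDist γ τ) (half_pos hη))
  obtain ⟨h, hh⟩ := exists_reparameterization_of_curveFrechetDist_lt
    (lt_add_of_pos_right (curveFrechetDist τ ρ) (half_pos hη))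
  refine curveFrechetDist_le (h.comp g) fun t => ?_
  calc ‖γ t - ρ (h.1 (g.1 t))‖ ≤ ‖γ t - τ (g.1 t)‖ + ‖τ (g.1 t) - ρ (h.1 (g.1 t))‖ :=
        norm_sub_le_norm_sub_add_norm_sub _ _ _
    _ ≤ _ := by linarith [hg t, hh (g.1 t)]

/-- The infimum over bijections does not change when monotone continuous maps of `[0,1]` onto
itself are admitted: such a map is a uniform limit of bijections `(1 - η) g + η id`. -/
theorem curveFrechetDist_le_of_monotone {r : ℝ} (g : unitInterval → unitInterval)
    (hc : Continuous g) (hm : Monotone g) (h0 : g 0 = 0) (h1 : g 1 = 1)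
    (hr : ∀ t, ‖γ t - τ (g t)‖ ≤ r) : curveFrechetDist γ τ ≤ r := by
  refine le_of_forall_pos_le_add fun η hη => ?_
  obtain ⟨κ, hκ, hτ⟩ := Metric.uniformContinuous_iff.1
    (CompactSpace.uniformContinuous_of_continuous τ.continuous) η hη
  obtain ⟨θ, hθ0, hθ⟩ : ∃ θ : ℝ, 0 < θ ∧ θ < min 1 κ := exists_between (by positivity)
  have hθ1 : θ < 1 := hθ.trans_le (min_le_left _ _)
  have hθκ : θ < κ := hθ.trans_le (min_le_right _ _)
  let f : unitInterval → unitInterval := fun t => ⟨(1 - θ) * g t + θ * t, by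
    have := (g t).2.1; have := t.2.1; have := (g t).2.2; have := t.2.2
    constructor <;> nlinarith⟩
  have hf0 : f 0 = 0 := Subtype.ext (by simp [f, h0])
  have hf1 : f 1 = 1 := Subtype.ext (by simp [f, h1])
  have hfc : Continuous f := Continuous.subtype_mk (by fun_prop) _
  have hfm : StrictMono f := fun a b hab => by
    have h2 : (g a : ℝ) ≤ g b := hm hab.le
    have h3 : (a : ℝ) < b := hab
    change (1 - θ) * (g a : ℝ) + θ * a < (1 - θ) * (g b : ℝ) + θ * b
    nlinarith
  have hfs : Function.Surjective f := fun y => by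
    have := intermediate_value_Icc (a := (0 : unitInterval)) (b := 1) zero_le_one hfc.continuousOn
    obtain ⟨x, -, hx⟩ := this (show y ∈ Set.Icc (f 0) (f 1) by
      rw [hf0, hf1]; exact ⟨unitInterval.nonneg', unitInterval.le_one'⟩)
    exact ⟨x, hx⟩
  refine curveFrechetDist_le ⟨f, hfc, ⟨hfm.injective, hfs⟩, hf0, hf1⟩ fun t => ?_
  have hd : dist (g t) (f t) < κ := by
    rw [Subtype.dist_eq, Real.dist_eq]
    have : (g t : ℝ) - f t = θ * (g t - t) := by simp only [f]; ring
    rw [this, abs_mul, abs_of_pos hθ0]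
    have : |(g t : ℝ) - t| ≤ 1 := by
      rw [abs_le]
      have := (g t).2.1; have := t.2.1; have := (g t).2.2; have := t.2.2
      constructor <;> linarith
    nlinarith
  have h2 := hτ hd
  rw [dist_eq_norm] at h2
  calc ‖γ t - τ (f t)‖ ≤ ‖γ t - τ (g t)‖ + ‖τ (g t) - τ (f t)‖ :=
        norm_sub_le_norm_sub_add_norm_sub _ _ _
    _ ≤ r + η := add_le_add (hr t) h2.le

end Curves

section PolygonalCurves

variable {d : ℕ}

theorem frechetDist_nonneg (γ τ : PolygonalCurve d) : 0 ≤ frechetDist γ τ :=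
  curveFrechetDist_nonneg

theorem frechetDist_comm (γ τ : PolygonalCurve d) : frechetDist γ τ = frechetDist τ γ :=
  curveFrechetDist_comm

theorem frechetDist_triangle (γ τ ρ : PolygonalCurve d) :
    frechetDist γ ρ ≤ frechetDist γ τ + frechetDist τ ρ :=
  curveFrechetDist_triangle

/-- Every instant lies on an edge of a curve with `n` edges. -/
theorem exists_edge_parameter {n : ℕ} (hn : 0 < n) (t : unitInterval) :
    ∃ (i : Fin n) (s : ℝ), s ∈ Set.Icc (0 : ℝ) 1 ∧ (n : ℝ) * t = i + s := by
  have hn' : (0 : ℝ) < n := by exact_mod_cast hn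
  have ht0 := t.2.1
  have ht1 := t.2.2
  rcases ht1.lt_or_eq with h | h
  · have hlt : ⌊(n : ℝ) * t⌋₊ < n := (Nat.floor_lt (by positivity)).2 (by nlinarith)
    refine ⟨⟨_, hlt⟩, n * t - ⌊(n : ℝ) * t⌋₊, ⟨?_, ?_⟩, by simp⟩
    · linarith [Nat.floor_le (show 0 ≤ (n : ℝ) * t by positivity)]
    · linarith [Nat.lt_floor_add_one ((n : ℝ) * t)]
  · refine ⟨⟨n - 1, by omega⟩, 1, by simp, ?_⟩
    rw [h, Nat.cast_sub (by omega)]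
    simp

theorem PolygonalCurve.toCurve_vertex (τ : PolygonalCurve d) (i : Fin (τ.edges + 1))
    (t : unitInterval) (ht : (τ.edges : ℝ) * t = i) : τ.toCurve t = τ.vertex i := by
  have hpos := τ.edges_pos
  by_cases hi : (i : ℕ) < τ.edges
  · rw [τ.toCurve_segment ⟨i, hi⟩ t 0 (by simp) (by simpa using ht)]
    simp
  · have hi' : (i : ℕ) = τ.edges := by omega
    rw [τ.toCurve_segment ⟨τ.edges - 1, by omega⟩ t 1 (by simp)
      (by rw [ht, hi']; simp [Nat.cast_sub (Nat.one_le_of_lt hpos)])]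
    simp only [sub_self, zero_smul, one_smul, zero_add]
    congr 1
    ext
    simp; omega

theorem norm_convexComb_sub_convexComb_le {E : Type*} [SeminormedAddCommGroup E] [NormedSpace ℝ E]
    {a b a' b' : E} {s r : ℝ} (hs : s ∈ Set.Icc (0 : ℝ) 1) (ha : ‖a - a'‖ ≤ r) (hb : ‖b - b'‖ ≤ r) :
    ‖(1 - s) • a + s • b - ((1 - s) • a' + s • b')‖ ≤ r := by
  have h1 : 0 ≤ 1 - s := by linarith [hs.2]
  rw [add_sub_add_comm, ← smul_sub, ← smul_sub]
  refine (norm_add_le _ _).trans ?_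
  rw [norm_smul, norm_smul, Real.norm_of_nonneg h1, Real.norm_of_nonneg hs.1]
  nlinarith [hs.1]

/-- Moving every vertex by at most `r` moves the curve by at most `r`. -/
theorem frechetDist_le_of_vertex {n : ℕ} (hn : 0 < n) (v w : Fin (n + 1) → EuclideanSpace ℝ (Fin d))
    {r : ℝ} (h : ∀ i, ‖v i - w i‖ ≤ r) : frechetDist ⟨n, hn, v⟩ ⟨n, hn, w⟩ ≤ r := by
  refine curveFrechetDist_le default fun t => ?_
  change ‖PolygonalCurve.toCurve _ t - PolygonalCurve.toCurve _ t‖ ≤ r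
  obtain ⟨i, s, hs, ht⟩ := exists_edge_parameter hn t
  rw [PolygonalCurve.toCurve_segment ⟨n, hn, v⟩ i t s hs ht,
    PolygonalCurve.toCurve_segment ⟨n, hn, w⟩ i t s hs ht]
  exact norm_convexComb_sub_convexComb_le hs (h _) (h _)

end PolygonalCurves

/-! ### Shortcutting a curve along another one -/

/-- Monotone maps `g 0, g 1, …, g (n - 1)`, where `g i` runs from `y i` to `y (i + 1)`, are glued to
a monotone map of `[0,1]` that follows `g i` during `[i / n, (i + 1) / n]`. -/
theorem exists_monotone_glue {n : ℕ} (hn : 0 < n) (y : ℕ → ℝ) (g : ℕ → ℝ → ℝ)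
    (hc : ∀ i < n, Continuous (g i)) (hm : ∀ i < n, Monotone (g i))
    (hg0 : ∀ i < n, g i 0 = y i) (hg1 : ∀ i < n, g i 1 = y (i + 1)) (hy0 : y 0 = 0)
    (hyn : y n = 1) :
    ∃ G : unitInterval → unitInterval, Continuous G ∧ Monotone G ∧ G 0 = 0 ∧ G 1 = 1 ∧
      ∀ (i : Fin n) (s : ℝ) (t : unitInterval), s ∈ Set.Icc (0 : ℝ) 1 → (n : ℝ) * t = i + s →
        (G t : ℝ) = g i s := by
  have hn' : (0 : ℝ) < n := by exact_mod_cast hn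
  let F : unitInterval → ℝ := fun t =>
    ∑ i ∈ Finset.range n, (g i (max 0 (min 1 ((n : ℝ) * t - i))) - y i)
  have hF : ∀ (i : Fin n) (s : ℝ) (t : unitInterval), s ∈ Set.Icc (0 : ℝ) 1 →
      (n : ℝ) * t = i + s → F t = g i s := by
    intro i s t hs ht
    obtain ⟨k, hk⟩ : ∃ k, n = (i : ℕ) + 1 + k := ⟨n - (i + 1), by omega⟩
    have h1 : ∀ j ∈ Finset.range (i : ℕ),
        g j (max 0 (min 1 ((n : ℝ) * t - j))) - y j = y (j + 1) - y j := by
      intro j hj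
      have hj := Finset.mem_range.1 hj
      have hj' : (j : ℝ) + 1 ≤ (i : ℕ) := by exact_mod_cast hj
      rw [min_eq_left (by rw [ht]; linarith [hs.1]), max_eq_right zero_le_one, hg1 j (by omega)]
    have h2 : ∀ j ∈ Finset.range k,
        g (i + 1 + j) (max 0 (min 1 ((n : ℝ) * t - ((i : ℕ) + 1 + j : ℕ)))) - y (i + 1 + j) = 0 := by
      intro j hj
      have hj := Finset.mem_range.1 hj
      rw [max_eq_left, hg0 _ (by omega), sub_self]
      refine (min_le_right _ _).trans ?_
      rw [ht]
      push_cast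
      linarith [hs.2, (Nat.cast_nonneg j : (0 : ℝ) ≤ j)]
    have h3 : max 0 (min 1 ((n : ℝ) * t - (i : ℕ))) = s := by
      rw [ht]; simp [hs.1, hs.2]
    simp only [F]
    rw [show Finset.range n = Finset.range ((i : ℕ) + 1 + k) by rw [← hk], Finset.sum_range_add,
      Finset.sum_range_succ, Finset.sum_congr rfl h1, Finset.sum_congr rfl h2, h3,
      Finset.sum_range_sub, hy0]
    simp
  have hFm : Monotone F := fun a b hab => by
    refine Finset.sum_le_sum fun i hi => sub_le_sub_right (hm i (Finset.mem_range.1 hi) ?_) _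
    have hab' : (a : ℝ) ≤ b := hab
    gcongr
  have hFc : Continuous F := by
    refine continuous_finsetSum _ fun i hi => ?_
    have := hc i (Finset.mem_range.1 hi)
    fun_prop
  have hF0 : F 0 = 0 := by
    rw [hF ⟨0, hn⟩ 0 0 (by simp) (by simp), hg0 _ hn, hy0]
  have hF1 : F 1 = 1 := by
    rw [hF ⟨n - 1, by omega⟩ 1 1 (by simp) (by simp [Nat.cast_sub (Nat.one_le_of_lt hn)]),
      hg1 _ (by simp; omega)]
    simp only [Nat.sub_add_cancel (Nat.one_le_of_lt hn), hyn]
  refine ⟨fun t => ⟨F t, ?_, ?_⟩, hFc.subtype_mk _, hFm, Subtype.ext hF0, Subtype.ext hF1, hF⟩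
  · rw [← hF0]; exact hFm unitInterval.nonneg'
  · rw [← hF1]; exact hFm unitInterval.le_one'

section Shortcut

variable {d : ℕ}

theorem PolygonalCurve.toCurve_convexComb (τ : PolygonalCurve d) (i : Fin τ.edges)
    {x y z : unitInterval} {a b s : ℝ} (ha : a ∈ Set.Icc (0 : ℝ) 1) (hb : b ∈ Set.Icc (0 : ℝ) 1)
    (hs : s ∈ Set.Icc (0 : ℝ) 1) (hx : (τ.edges : ℝ) * x = i + a) (hy : (τ.edges : ℝ) * y = i + b)
    (hz : (z : ℝ) = (1 - s) * x + s * y) :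
    τ.toCurve z = (1 - s) • τ.toCurve x + s • τ.toCurve y := by
  rw [τ.toCurve_segment i x a ha hx, τ.toCurve_segment i y b hb hy,
    τ.toCurve_segment i z ((1 - s) * a + s * b)
      (convex_Icc (0 : ℝ) 1 ha hb (by linarith [hs.2]) hs.1 (by ring))
      (by rw [hz]; linear_combination (1 - s) * hx + s * hy)]
  module

/-- If the edges of a polygonal curve can be traversed along with consecutive pieces of `τ`, given
by monotone maps `g i`, at distance at most `r`, then the Fréchet distance is at most `r`. -/
theorem frechetDist_le_of_edges (τ : PolygonalCurve d) {n : ℕ} (hn : 0 < n)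
    (v : ℕ → EuclideanSpace ℝ (Fin d)) (y : ℕ → ℝ) {r : ℝ} (hy0 : y 0 = 0) (hyn : y n = 1)
    (h : ∀ i < n, ∃ g : ℝ → ℝ, Continuous g ∧ Monotone g ∧ g 0 = y i ∧ g 1 = y (i + 1) ∧
      ∀ s ∈ Set.Icc (0 : ℝ) 1, ∀ t : unitInterval, (t : ℝ) = g s →
        ‖(1 - s) • v i + s • v (i + 1) - τ.toCurve t‖ ≤ r) :
    frechetDist ⟨n, hn, fun i => v i⟩ τ ≤ r := by
  have h' : ∀ i, ∃ g : ℝ → ℝ, i < n → Continuous g ∧ Monotone g ∧ g 0 = y i ∧ g 1 = y (i + 1) ∧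
      ∀ s ∈ Set.Icc (0 : ℝ) 1, ∀ t : unitInterval, (t : ℝ) = g s →
        ‖(1 - s) • v i + s • v (i + 1) - τ.toCurve t‖ ≤ r := fun i => by
    by_cases hi : i < n
    · obtain ⟨g, hg⟩ := h i hi
      exact ⟨g, fun _ => hg⟩
    · exact ⟨id, fun h => absurd h hi⟩
  choose g hg using h'
  obtain ⟨G, hGc, hGm, hG0, hG1, hG⟩ := exists_monotone_glue hn y g (fun i hi => (hg i hi).1)
    (fun i hi => (hg i hi).2.1) (fun i hi => (hg i hi).2.2.1) (fun i hi => (hg i hi).2.2.2.1) hy0 hyn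
  refine curveFrechetDist_le_of_monotone G hGc hGm hG0 hG1 fun t => ?_
  obtain ⟨i, s, hs, ht⟩ := exists_edge_parameter hn t
  rw [PolygonalCurve.toCurve_segment ⟨n, hn, fun i => v i⟩ i t s hs ht]
  exact (hg i i.2).2.2.2.2 s hs _ (hG i s t hs ht)

/-- The vertices of `σ` are replaced as follows. Under a matching of `σ` with `τ` at distance at
most `r`, an inner vertex of `σ` is matched with a point of some edge of `τ`; it is replaced by the
two points of `σ` that are matched with the end points of this edge. The new curve runs along `σ`
between these pairs, and in between it is a segment that can be matched with an edge of `τ`. -/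
theorem exists_shortcut {ℓ : ℕ} (hℓ : 2 ≤ ℓ) (σ τ : PolygonalCurve d) (hσ : σ.complexity ≤ ℓ)
    {r : ℝ} (hr : frechetDist σ τ < r) :
    ∃ v : Fin (2 * ℓ - 3 + 1) → EuclideanSpace ℝ (Fin d),
      (∀ i, ∃ j, ‖v i - τ.vertex j‖ ≤ r) ∧
        frechetDist ⟨2 * ℓ - 3, by omega, v⟩ τ ≤ r := by
  rw [frechetDist_comm] at hr
  obtain ⟨k, hk⟩ := exists_reparameterization_of_curveFrechetDist_lt hr
  set h := k.symm
  have hkm : Monotone k.1 := k.strictMono.monotone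
  have hhm : Monotone h.1 := h.strictMono.monotone
  obtain ⟨n, hn0, w⟩ := σ
  obtain ⟨M, hM0, u⟩ := τ
  set σ : PolygonalCurve d := ⟨n, hn0, w⟩
  set τ : PolygonalCurve d := ⟨M, hM0, u⟩
  simp only [PolygonalCurve.complexity, σ] at hσ
  have hM : (0 : ℝ) < M := by exact_mod_cast hM0
  have hn : (0 : ℝ) < n := by exact_mod_cast hn0
  -- `q N j` is the instant `j / N`, truncated to `[0,1]`, so that `A` and `B` below are constant
  -- beyond the last vertex of `σ`, and the new curve gets `2ℓ - 2` vertices even if `σ` has fewer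
  -- than `ℓ`.
  let q : ℕ → ℕ → unitInterval := fun N j => Set.projIcc 0 1 zero_le_one ((j : ℝ) / N)
  have hq : ∀ {N j : ℕ}, j ≤ N → (q N j : ℝ) = j / N := fun {N j} hj => by
    have : (j : ℝ) / N ∈ Set.Icc (0 : ℝ) 1 :=
      ⟨by positivity, div_le_one_of_le₀ (by exact_mod_cast hj) (by positivity)⟩
    simp only [q, Set.projIcc_of_mem zero_le_one this]
  have hqm : ∀ N, Monotone (q N) := fun N a b hab =>
    Set.monotone_projIcc zero_le_one (by gcongr)
  let θ : ℕ → unitInterval := fun e => h.1 (q n e)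
  have hθm : Monotone θ := hhm.comp (hqm n)
  -- The vertices of the edge of `τ` that contains the point matched with vertex `e` of `σ`.
  let A : ℕ → ℕ := fun e => ⌊(M : ℝ) * θ e⌋₊
  let B : ℕ → ℕ := fun e => ⌈(M : ℝ) * θ e⌉₊
  have hBm : ∀ e, B e ≤ B (e + 1) := fun e => by
    have : (θ e : ℝ) ≤ θ (e + 1) := hθm (Nat.le_succ e)
    exact Nat.ceil_mono (by gcongr)
  have hAB : ∀ e, A e ≤ B e := fun e => Nat.floor_le_ceil _
  have hBA : ∀ e, B e ≤ A e + 1 := fun e => Nat.ceil_le_floor_add_one _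
  have hBM : ∀ e, B e ≤ M := fun e => Nat.ceil_le.2 (by have := (θ e).2.2; nlinarith)
  have hB0 : B 0 = 0 := by
    have : q n 0 = 0 := Subtype.ext (by rw [hq (Nat.zero_le _)]; simp)
    simp [B, θ, this, h.2.2.2.1]
  have hend : ∀ e, n ≤ e → A e = M ∧ B e = M := fun e he => by
    have : q n e = 1 := Set.projIcc_of_right_le _ (by
      rw [le_div_iff₀ hn]; simpa using he)
    simp [A, B, θ, this, h.2.2.2.2]
  -- New vertex `i` is the point of `σ` that is matched with vertex `N i` of `τ`. The maximum makes
  -- the sequence monotone if two consecutive vertices of `σ` are matched with the same edge.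
  let N : ℕ → ℕ := fun i => if i % 2 = 0 then B (i / 2) else max (B (i / 2)) (A (i / 2 + 1))
  have hNM : ∀ i, N i ≤ M := fun i => by
    simp only [N]
    have := hBM (i / 2); have := hBM (i / 2 + 1); have := hAB (i / 2 + 1)
    split_ifs <;> omega
  let x : ℕ → unitInterval := fun i => k.1 (q M (N i))
  have hqN : ∀ i, (M : ℝ) * q M (N i) = N i := fun i => by
    rw [hq (hNM i)]; field_simp
  have hx : ∀ i, ‖σ.toCurve (x i) - τ.toCurve (q M (N i))‖ ≤ r := fun i => by
    rw [norm_sub_rev]; exact hk _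
  have hxhead : ∀ e, q n e ≤ k.1 (q M (B e)) := fun e => by
    have : θ e ≤ q M (B e) := by
      change (θ e : ℝ) ≤ q M (B e)
      rw [hq (hBM e), le_div_iff₀ hM, mul_comm]
      exact Nat.le_ceil _
    calc q n e = k.1 (θ e) := (k.apply_symm_apply _).symm
      _ ≤ _ := hkm this
  have hxtail : ∀ e, k.1 (q M (A e)) ≤ q n e := fun e => by
    have : q M (A e) ≤ θ e := by
      change (q M (A e) : ℝ) ≤ θ e
      rw [hq ((hAB e).trans (hBM e)), div_le_iff₀ hM, mul_comm]
      exact Nat.floor_le (mul_nonneg hM.le (θ e).2.1)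
    calc _ ≤ k.1 (θ e) := hkm this
      _ = q n e := k.apply_symm_apply _
  refine ⟨fun i => σ.toCurve (x i), fun i => ⟨⟨N i, Nat.lt_succ_of_le (hNM i)⟩, ?_⟩, ?_⟩
  · rw [← τ.toCurve_vertex _ (q M (N i)) (hqN i)]
    exact hx i
  refine frechetDist_le_of_edges τ (by omega) (fun i => σ.toCurve (x i)) (fun i => q M (N i))
    ?_ ?_ fun i hi => ?_
  · rw [hq (hNM 0)]
    simp [N, hB0]
  · have h1 : N (2 * ℓ - 3) = M := by
      have h2 : (2 * ℓ - 3) % 2 = 1 := by omega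
      have h3 : (2 * ℓ - 3) / 2 + 1 = ℓ - 1 := by omega
      have h4 := hBM ((2 * ℓ - 3) / 2)
      simp only [N, h2, h3, (hend (ℓ - 1) (by omega)).1]
      simpa using h4
    rw [hq (hNM _), h1, div_self hM.ne']
  by_cases hstep : N (i + 1) = N i ∨ N (i + 1) = N i + 1
  · -- The new edge is matched with a vertex or with a whole edge of `τ`.
    have hle : (q M (N i) : ℝ) ≤ q M (N (i + 1)) := hqm M (by omega)
    refine ⟨fun s => (1 - s) * q M (N i) + s * q M (N (i + 1)), by fun_prop, fun a b hab => ?_,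
      by simp, by simp, fun s hs t ht => ?_⟩
    · nlinarith
    · have : τ.toCurve t = (1 - s) • τ.toCurve (q M (N i)) + s • τ.toCurve (q M (N (i + 1))) := by
        rcases hstep with h1 | h1
        · have : t = q M (N i) := Subtype.ext (by rw [ht, h1]; ring)
          rw [this, h1]; module
        · have := hNM (i + 1)
          exact τ.toCurve_convexComb ⟨N i, by simp only [τ]; omega⟩ (a := 0) (b := 1) (by simp)
            (by simp) hs (by simpa using hqN i)
            (by have := hqN (i + 1); rw [h1] at this ⊢; simpa using this) ht
      rw [this]
      exact norm_convexComb_sub_convexComb_le hs (hx i) (hx (i + 1))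
  · -- The new edge runs along an edge of `σ`.
    have hB := hBm (i / 2); have hAB' := hAB (i / 2 + 1); have hBA' := hBA (i / 2 + 1)
    have hpar : i % 2 = 0 := by
      by_contra hodd
      have h1 : (i + 1) % 2 = 0 := by omega
      have h2 : (i + 1) / 2 = i / 2 + 1 := by omega
      simp only [N, hodd, h1, h2, if_true, if_false] at hstep
      omega
    have h1 : ¬ (i + 1) % 2 = 0 := by omega
    have h2 : (i + 1) / 2 = i / 2 := by omega
    have hNi : N i = B (i / 2) := by simp only [N, hpar, if_true]
    have hNi1 : N (i + 1) = max (B (i / 2)) (A (i / 2 + 1)) := by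
      simp only [N, h1, h2, if_false]
    have hlt : B (i / 2) < A (i / 2 + 1) := by omega
    have hNi1' : N (i + 1) = A (i / 2 + 1) := by omega
    have hen : i / 2 < n := by
      by_contra hge
      have := (hend (i / 2) (by omega)).2
      have := hBM (i / 2 + 1)
      omega
    set e := i / 2
    have hxx : x i ≤ x (i + 1) := hkm (hqm M (by omega))
    have hxx' : (x i : ℝ) ≤ x (i + 1) := hxx
    have hlo : (e : ℝ) ≤ n * x i := by
      have : (q n e : ℝ) ≤ x i := by simp only [x, hNi]; exact hxhead e
      rw [hq hen.le, div_le_iff₀ hn] at this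
      linarith
    have hhi : (n : ℝ) * x (i + 1) ≤ e + 1 := by
      have : (x (i + 1) : ℝ) ≤ q n (e + 1) := by simp only [x, hNi1']; exact hxtail (e + 1)
      rw [hq hen, le_div_iff₀ hn] at this
      push_cast at this
      linarith
    have hmul : (n : ℝ) * x i ≤ n * x (i + 1) := by gcongr
    have hhx : ∀ i, h.1 (x i) = q M (N i) := fun i => k.symm_apply_apply _
    have hch := h.2.1
    refine ⟨fun s => (h.1 (Set.projIcc 0 1 zero_le_one ((1 - s) * x i + s * x (i + 1))) : ℝ),
      by fun_prop, fun a b hab => ?_, ?_, ?_, fun s hs t ht => ?_⟩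
    · refine hhm (Set.monotone_projIcc zero_le_one ?_)
      nlinarith
    · simp [hhx]
    · simp [hhx]
    · have hmem : (1 - s) * x i + s * x (i + 1) ∈ Set.Icc (0 : ℝ) 1 :=
        convex_Icc (0 : ℝ) 1 (x i).2 (x (i + 1)).2 (by linarith [hs.2]) hs.1 (by ring)
      beta_reduce at ht
      rw [Set.projIcc_of_mem zero_le_one hmem] at ht
      have ht' : t = h.1 ⟨_, hmem⟩ := Subtype.ext ht
      have hkt : k.1 t = ⟨_, hmem⟩ := by rw [ht']; exact k.apply_symm_apply _
      have hseg := σ.toCurve_convexComb ⟨e, hen⟩ (x := x i) (y := x (i + 1)) (z := k.1 t)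
        (a := n * x i - e) (b := n * x (i + 1) - e) (s := s) ⟨by linarith, by linarith⟩
        ⟨by linarith, by linarith⟩ hs (by simp [σ]) (by simp [σ]) (by rw [hkt])
      rw [← hseg, norm_sub_rev]
      exact hk t

end Shortcut

/-! ### Uniform probabilities on finite types -/

open scoped BigOperators

section UniformProb

variable {Ω α κ ι : Type*} [Fintype Ω] [Fintype α] [Fintype κ] [Fintype ι]

open Classical in
/-- The probability of an event under the uniform distribution on a finite type, written as the
average of its indicator function. -/
noncomputable def uniformProb (p : Ω → Prop) : ℝ := 𝔼 ω, if p ω then 1 else 0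

theorem uniformProb_le_expect {p : Ω → Prop} {f : Ω → ℝ} (h0 : ∀ ω, 0 ≤ f ω)
    (h1 : ∀ ω, p ω → 1 ≤ f ω) : uniformProb p ≤ 𝔼 ω, f ω := by
  refine Finset.expect_le_expect fun ω _ => ?_
  split_ifs with h
  exacts [h1 ω h, h0 ω]

theorem uniformProb_nonneg (p : Ω → Prop) : 0 ≤ uniformProb p :=
  Finset.expect_nonneg fun ω _ => by positivity

theorem uniformProb_mono {p q : Ω → Prop} (h : ∀ ω, p ω → q ω) :
    uniformProb p ≤ uniformProb q :=
  uniformProb_le_expect (fun ω => by positivity) fun ω hω => by simp [h ω hω]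

theorem uniformProb_eq_zero {p : Ω → Prop} (h : ∀ ω, ¬ p ω) : uniformProb p = 0 :=
  Finset.expect_eq_zero fun ω _ => if_neg (h ω)

theorem uniformProb_or_le (p q : Ω → Prop) :
    uniformProb (fun ω => p ω ∨ q ω) ≤ uniformProb p + uniformProb q := by
  rw [uniformProb, uniformProb, uniformProb, ← Finset.expect_add_distrib]
  refine Finset.expect_le_expect fun ω _ => ?_
  by_cases hp : p ω <;> by_cases hq : q ω <;> simp [hp, hq]

theorem uniformProb_exists_le (p : ι → Ω → Prop) :
    uniformProb (fun ω => ∃ i, p i ω) ≤ ∑ i, uniformProb (p i) := by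
  classical
  have : ∑ i, uniformProb (p i) = 𝔼 ω, ∑ i, if p i ω then (1 : ℝ) else 0 := by
    rw [Finset.expect_sum_comm]; rfl
  rw [this]
  refine uniformProb_le_expect (fun ω => by positivity) ?_
  rintro ω ⟨i, hi⟩
  have := Finset.single_le_sum (f := fun i => if p i ω then (1 : ℝ) else 0)
    (fun i _ => by positivity) (Finset.mem_univ i)
  simpa [hi] using this

theorem uniformProb_equiv (e : Ω ≃ α) (p : α → Prop) :
    uniformProb (fun ω => p (e ω)) = uniformProb p :=
  Fintype.expect_equiv e _ _ fun _ => rfl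

/-- If, given any value of the first coordinate, an event has probability at most `c`, then it has
probability at most `c`. -/
theorem uniformProb_prod_le [Nonempty Ω] {p : Ω × α → Prop} {c : ℝ}
    (h : ∀ a, uniformProb (fun b => p (a, b)) ≤ c) : uniformProb p ≤ c := by
  rw [uniformProb, ← Finset.univ_product_univ, Finset.expect_product]
  exact Finset.expect_le Finset.univ_nonempty fun a _ => h a

open Classical in
theorem uniformProb_fst [Nonempty α] (p : Ω → Prop) :
    uniformProb (fun x : Ω × α => p x.1) = uniformProb p := by
  rw [uniformProb, ← Finset.univ_product_univ, Finset.expect_product]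
  exact Finset.expect_congr rfl fun a _ => Fintype.expect_const (if p a then (1 : ℝ) else 0)

/-- A coordinate of a uniformly distributed family is uniformly distributed. -/
theorem uniformProb_pi_eval {X : κ → Type*} [DecidableEq κ] [∀ i, Fintype (X i)]
    [∀ i, Nonempty (X i)] (i : κ) (p : X i → Prop) :
    uniformProb (fun f : ∀ i, X i => p (f i)) = uniformProb p := by
  rw [← uniformProb_fst (α := ∀ j : {j // j ≠ i}, X j) p, ← uniformProb_equiv (Equiv.piSplitAt i X)]
  rfl

theorem uniformProb_const_pi_forall (n : ℕ) (p : α → Prop) :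
    uniformProb (fun f : Fin n → α => ∀ j, p (f j)) = uniformProb p ^ n := by
  classical
  rw [uniformProb, uniformProb, Finset.expect_pow, Fintype.piFinset_univ]
  refine Finset.expect_congr rfl fun f _ => ?_
  by_cases h : ∀ j, p (f j)
  · simp [h]
  · obtain ⟨j, hj⟩ := not_forall.1 h
    rw [if_neg h, Finset.prod_eq_zero (Finset.mem_univ j) (by simp [hj])]

/-- The measure of an event under Mathlib's uniform measure, through the complementary event. -/
theorem uniformOn_univ_real [MeasurableSpace Ω] [MeasurableSingletonClass Ω] [Nonempty Ω]
    (p : Ω → Prop) :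
    (uniformOn (Set.univ : Set Ω)).real {ω | p ω} = 1 - uniformProb fun ω => ¬ p ω := by
  classical
  have h1 : (1 : ℝ) = 𝔼 _ω : Ω, (1 : ℝ) := (Fintype.expect_const _).symm
  rw [Measure.real, uniformOn_univ, Measure.count_apply_finite _ (Set.toFinite _), uniformProb, h1,
    ← Finset.expect_sub_distrib, Fintype.expect_eq_sum_div_card, ENNReal.toReal_div]
  congr 1
  simp only [ENNReal.toReal_natCast, Set.Finite.toFinset_ofPred, Finset.card_filter]
  push_cast
  refine Finset.sum_congr rfl fun ω _ => ?_
  by_cases h : p ω <;> simp [h]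

/-- Markov's inequality, including the case of average zero. -/
theorem expect_indicator_mul_expect_lt_le {β : Type*} {s : Finset β} {f : β → ℝ}
    (hf : ∀ x ∈ s, 0 ≤ f x) {a μ : ℝ} (ha : 0 < a) (hμdef : μ = 𝔼 y ∈ s, f y) [DecidablePred fun x => a * μ < f x] :
    (𝔼 x ∈ s, if a * μ < f x then (1 : ℝ) else 0) ≤ 1 / a := by
  have hμ : 0 ≤ μ := hμdef ▸ Finset.expect_nonneg hf
  rcases hμ.eq_or_lt with h | h
  · have h0 : ∀ x ∈ s, f x = 0 := by
      rcases s.eq_empty_or_nonempty with rfl | hs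
      · simp
      · intro x hx
        by_contra hne
        have := Finset.expect_pos' hf ⟨x, hx, lt_of_le_of_ne (hf x hx) (Ne.symm hne)⟩
        linarith
    rw [Finset.expect_eq_zero]
    · positivity
    · intro x hx
      simp [h0 x hx, ← h]
  · rw [le_div_iff₀ ha]
    have h2 : (𝔼 x ∈ s, if a * μ < f x then (1 : ℝ) else 0) * (a * μ) ≤ μ := by
      rw [Finset.expect_mul]
      refine (Finset.expect_le_expect fun x hx => ?_).trans hμdef.ge
      split_ifs with hx'
      · linarith
      · linarith [hf x hx]
    by_contra! hc
    nlinarith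

/-- A Hoeffding type bound: if `X` takes values in `[-D, D]` and has mean at least `D / 2`, then it
is exponentially unlikely that `n` independent copies of it have a nonpositive sum. -/
theorem uniformProb_sum_nonpos_le [Nonempty α] (n : ℕ) (X : α → ℝ) {D : ℝ} (hD : 0 < D)
    (hX : ∀ x, |X x| ≤ D) (hm : D / 2 ≤ 𝔼 x, X x) :
    uniformProb (fun f : Fin n → α => ∑ j, X (f j) ≤ 0) ≤ Real.exp (-(n / 16)) := by
  -- Markov's inequality for `exp (-∑ X / (4 D))`.
  have h1 : uniformProb (fun f : Fin n → α => ∑ j, X (f j) ≤ 0)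
      ≤ 𝔼 f : Fin n → α, ∏ j, Real.exp (-(X (f j) / (4 * D))) := by
    refine uniformProb_le_expect (fun f => by positivity) fun f hf => ?_
    rw [← Real.exp_sum, Real.one_le_exp_iff, Finset.sum_neg_distrib, ← Finset.sum_div]
    have := div_nonpos_of_nonpos_of_nonneg hf (by positivity : 0 ≤ 4 * D)
    linarith
  have h2 : (𝔼 f : Fin n → α, ∏ j, Real.exp (-(X (f j) / (4 * D))))
      = (𝔼 x, Real.exp (-(X x / (4 * D)))) ^ n := by
    rw [Finset.expect_pow, Fintype.piFinset_univ]
  -- The second-order bound `exp y ≤ 1 + y + y ^ 2` at `y = -X / (4 D)`.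
  have h3 : (𝔼 x, Real.exp (-(X x / (4 * D)))) ≤ 1 - 1 / 16 := by
    calc (𝔼 x, Real.exp (-(X x / (4 * D)))) ≤ 𝔼 x, (17 / 16 - X x / (4 * D)) := by
          refine Finset.expect_le_expect fun x _ => ?_
          have hy : |X x / (4 * D)| ≤ 1 / 4 := by
            rw [abs_div, abs_of_pos (by positivity : 0 < 4 * D), div_le_iff₀ (by positivity)]
            linarith [hX x]
          have h4 := Real.abs_exp_sub_one_sub_id_le (x := -(X x / (4 * D)))
            (by rw [abs_neg]; linarith)
          have h5 : (X x / (4 * D)) ^ 2 ≤ (1 / 4) ^ 2 := sq_le_sq' (by linarith [abs_le.1 hy])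
            (abs_le.1 hy).2
          have := (abs_le.1 h4).2
          nlinarith
      _ = 17 / 16 - (𝔼 x, X x) / (4 * D) := by
          rw [Finset.expect_sub_distrib, Fintype.expect_const, Finset.expect_div]
      _ ≤ 1 - 1 / 16 := by
          have : 1 / 8 ≤ (𝔼 x, X x) / (4 * D) := by
            rw [le_div_iff₀ (by positivity)]; linarith
          linarith
  calc _ ≤ (𝔼 x, Real.exp (-(X x / (4 * D)))) ^ n := h1.trans h2.le
    _ ≤ (1 - 1 / 16) ^ n :=
        pow_le_pow_left₀ (Finset.expect_nonneg fun _ _ => (Real.exp_pos _).le) h3 n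
    _ ≤ Real.exp (-(1 / 16)) ^ n :=
        pow_le_pow_left₀ (by norm_num) (by linarith [Real.add_one_le_exp (-(1 / 16 : ℝ))]) n
    _ = Real.exp (-(n / 16)) := by rw [← Real.exp_nat_mul]; ring_nf

end UniformProb

section Samples

variable {α : Type*} [Fintype α] [DecidableEq α] {n : ℕ}

/-- The positions at which a sample hits the set `A`. -/
noncomputable def hits (A : Finset α) (f : Fin n → α) : Finset (Fin n) :=
  Finset.univ.filter fun j => f j ∈ A

/-- A Chernoff type bound: a sample is unlikely to hit `A` less than half as often as expected. -/
theorem uniformProb_card_hits_lt_le [Nonempty α] (A : Finset α) {x : ℝ} (hx : 0 ≤ x)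
    (hA : 2 * x ≤ n * (A.card / Fintype.card α)) :
    uniformProb (fun f : Fin n → α => ((hits A f).card : ℝ) < x) ≤ Real.exp (-(x / 4)) := by
  have hlog : Real.log 2 < 3 / 4 := by linarith [Real.log_two_lt_d9]
  set p : ℝ := A.card / Fintype.card α with hp
  have hp1 : p ≤ 1 := div_le_one_of_le₀ (by exact_mod_cast Finset.card_le_univ A) (by positivity)
  -- Markov's inequality for `2 ^ (x - (hits A f).card)`, whose average is `2 ^ x * (1 - p / 2) ^ n`.
  have h1 : uniformProb (fun f : Fin n → α => ((hits A f).card : ℝ) < x)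
      ≤ 𝔼 f : Fin n → α, Real.exp (Real.log 2 * x) * ∏ j, (if f j ∈ A then (1 / 2 : ℝ) else 1) := by
    refine uniformProb_le_expect (fun f => mul_nonneg (Real.exp_pos _).le
      (Finset.prod_nonneg fun _ _ => by positivity)) fun f hf => ?_
    have h2 : ∏ j, (if f j ∈ A then (1 / 2 : ℝ) else 1)
        = Real.exp (-(Real.log 2 * (hits A f).card)) := by
      rw [Finset.prod_ite, Finset.prod_const, Finset.prod_const_one, mul_one, Real.exp_neg,
        mul_comm, Real.exp_nat_mul, Real.exp_log two_pos, one_div, inv_pow, hits]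
    rw [h2, ← Real.exp_add, Real.one_le_exp_iff]
    nlinarith [Real.log_pos one_lt_two]
  have h2 : (𝔼 y : α, if y ∈ A then (1 / 2 : ℝ) else 1) = 1 - p / 2 := by
    have : ∀ y : α, (if y ∈ A then (1 / 2 : ℝ) else 1) = 1 - (if y ∈ A then (1 : ℝ) else 0) / 2 :=
      fun y => by split_ifs <;> norm_num
    simp_rw [this]
    rw [Finset.expect_sub_distrib, Fintype.expect_const, ← Finset.expect_div,
      Fintype.expect_eq_sum_div_card]
    simp [hp]
  rw [← Finset.mul_expect] at h1
  have h3 : (𝔼 f : Fin n → α, ∏ j, (if f j ∈ A then (1 / 2 : ℝ) else 1)) = (1 - p / 2) ^ n := by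
    rw [← h2, Finset.expect_pow, Fintype.piFinset_univ]
  rw [h3] at h1
  calc _ ≤ Real.exp (Real.log 2 * x) * (1 - p / 2) ^ n := h1
    _ ≤ Real.exp (Real.log 2 * x) * Real.exp (-(p / 2)) ^ n := by
        gcongr
        · linarith
        · linarith [Real.add_one_le_exp (-(p / 2))]
    _ = Real.exp (Real.log 2 * x - n * p / 2) := by
        rw [← Real.exp_nat_mul, ← Real.exp_add]; ring_nf
    _ ≤ Real.exp (-(x / 4)) := Real.exp_le_exp.2 (by nlinarith)

theorem filter_hits_eq (A : Finset α) (H : Finset (Fin n)) :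
    (Finset.univ.filter fun f : Fin n → α => hits A f = H)
      = Fintype.piFinset fun j => if j ∈ H then A else Aᶜ := by
  ext f
  simp only [Finset.mem_filter, Finset.mem_univ, true_and, Fintype.mem_piFinset, hits,
    Finset.ext_iff]
  refine forall_congr' fun j => ?_
  by_cases h : j ∈ H <;> simp [h]

/-- Given the set `H` of positions at which a sample hits `A`, its values at these positions are
independent and uniformly distributed on `A`. -/
theorem sum_hits_eq_prod (A : Finset α) {J H : Finset (Fin n)} (hJ : J ⊆ H) (b : α → ℝ) :
    ∑ f : Fin n → α with hits A f = H, ∏ j ∈ J, b (f j)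
      = (𝔼 x ∈ A, b x) ^ J.card * (Finset.univ.filter fun f : Fin n → α => hits A f = H).card := by
  rw [filter_hits_eq, Fintype.card_piFinset]
  have h1 : ∀ f : Fin n → α, ∏ j ∈ J, b (f j) = ∏ j, if j ∈ J then b (f j) else 1 := fun f => by
    rw [Finset.prod_ite_mem, Finset.univ_inter]
  simp_rw [h1]
  rw [← Finset.prod_univ_sum (fun j => if j ∈ H then A else Aᶜ)
    (fun j x => if j ∈ J then b x else 1)]
  have h2 : ∀ j, (∑ x ∈ if j ∈ H then A else Aᶜ, if j ∈ J then b x else 1)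
      = (if j ∈ J then 𝔼 x ∈ A, b x else 1) * ((if j ∈ H then A else Aᶜ).card : ℝ) := fun j => by
    by_cases hj : j ∈ J
    · simp only [hj, hJ hj, if_true]
      rw [mul_comm, Finset.card_mul_expect]
    · simp [hj]
  rw [Finset.prod_congr rfl fun j _ => h2 j, Finset.prod_mul_distrib, Finset.prod_ite_mem,
    Finset.univ_inter, Finset.prod_const]
  push_cast
  rfl

/-- If an event has conditional probability at most `c` given each value of `X`, then it has
probability at most `c`. -/
theorem uniformProb_le_of_fiberwise {Ω β : Type*} [Fintype Ω] [Nonempty Ω] [Fintype β]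
    [DecidableEq β] (X : Ω → β) {p : Ω → Prop} [DecidablePred p] {c : ℝ}
    (h : ∀ b, ∑ ω with X ω = b, (if p ω then (1 : ℝ) else 0)
      ≤ c * (Finset.univ.filter fun ω => X ω = b).card) : uniformProb p ≤ c := by
  have h1 : uniformProb p = 𝔼 ω, if p ω then (1 : ℝ) else 0 := by
    refine Finset.expect_congr rfl fun ω _ => ?_
    congr
  rw [h1, Fintype.expect_eq_sum_div_card, div_le_iff₀ (by exact_mod_cast Fintype.card_pos),
    ← Finset.sum_fiberwise (g := X)]
  refine (Finset.sum_le_sum fun b _ => h b).trans ?_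
  rw [← Finset.mul_sum]
  have h2 : (Fintype.card Ω : ℝ)
      = ∑ b, ((Finset.univ.filter fun ω => X ω = b).card : ℝ) := by
    rw [← Nat.cast_sum]
    congr 1
    exact Finset.card_eq_sum_card_fiberwise (fun _ _ => Finset.mem_coe.2 (Finset.mem_univ _))
  rw [h2]

/-- Let `J H` consist of `k` of the positions at which a sample hits `A`, chosen knowing the set
`H` of these positions only. If few elements of `A` satisfy `b`, it is unlikely that
all elements sampled at the positions `J H` do. -/
theorem uniformProb_forall_mem_le [Nonempty α] (A : Finset α) (J : Finset (Fin n) → Finset (Fin n))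
    {k : ℕ} (hJ : ∀ H, k ≤ H.card → J H ⊆ H ∧ (J H).card = k) (b : α → Prop) [DecidablePred b]
    {θ : ℝ} (hθ : (𝔼 x ∈ A, if b x then (1 : ℝ) else 0) ≤ θ) :
    uniformProb (fun f : Fin n → α => k ≤ (hits A f).card ∧ ∀ j ∈ J (hits A f), b (f j))
      ≤ θ ^ k := by
  have h0 : 0 ≤ 𝔼 x ∈ A, if b x then (1 : ℝ) else 0 :=
    Finset.expect_nonneg fun _ _ => by positivity
  classical
  refine uniformProb_le_of_fiberwise (hits A) fun H => ?_
  by_cases hk : k ≤ H.card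
  · obtain ⟨hJH, hcard⟩ := hJ H hk
    calc _ ≤ ∑ f : Fin n → α with hits A f = H, ∏ j ∈ J H, if b (f j) then (1 : ℝ) else 0 := by
          refine Finset.sum_le_sum fun f hf => ?_
          rw [(Finset.mem_filter.1 hf).2]
          split_ifs with h
          · rw [Finset.prod_congr rfl fun j hj => if_pos (h.2 j hj), Finset.prod_const_one]
          · exact Finset.prod_nonneg fun _ _ => by positivity
      _ ≤ _ := by
          rw [sum_hits_eq_prod A hJH (fun x => if b x then (1 : ℝ) else 0), hcard]
          gcongr
  · rw [Finset.sum_eq_zero]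
    · have : 0 ≤ θ := h0.trans hθ
      positivity
    · intro f hf
      rw [(Finset.mem_filter.1 hf).2, if_neg fun h => hk h.1]

/-- Markov's inequality for the sum of `φ` over the elements sampled at the positions `J H`, where
`J H` is as in `uniformProb_forall_mem_le`. -/
theorem uniformProb_lt_sum_mem_le [Nonempty α] (A : Finset α)
    (J : Finset (Fin n) → Finset (Fin n)) {k : ℕ} (hk0 : 0 < k)
    (hJ : ∀ H, k ≤ H.card → J H ⊆ H ∧ (J H).card = k) (φ : α → ℝ) (hφ : ∀ x, 0 ≤ φ x)
    (hμ : 0 < 𝔼 x ∈ A, φ x) {θ : ℝ} (hθ : 0 < θ) :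
    uniformProb (fun f : Fin n → α => k ≤ (hits A f).card ∧
      k * (𝔼 x ∈ A, φ x) / θ < ∑ j ∈ J (hits A f), φ (f j)) ≤ θ := by
  set μ := 𝔼 x ∈ A, φ x with hμdef
  have hk' : (0 : ℝ) < k := by exact_mod_cast hk0
  classical
  refine uniformProb_le_of_fiberwise (hits A) fun H => ?_
  by_cases hk : k ≤ H.card
  · obtain ⟨hJH, hcard⟩ := hJ H hk
    have h1 : ∀ j ∈ J H, ∑ f : Fin n → α with hits A f = H, φ (f j)
        = μ * (Finset.univ.filter fun f : Fin n → α => hits A f = H).card := fun j hj => by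
      simpa using sum_hits_eq_prod A (J := {j}) (by simpa using hJH hj) φ
    calc _ ≤ ∑ f : Fin n → α with hits A f = H, θ / (k * μ) * ∑ j ∈ J H, φ (f j) := by
          refine Finset.sum_le_sum fun f hf => ?_
          rw [(Finset.mem_filter.1 hf).2]
          split_ifs with h
          · have := h.2
            rw [div_lt_iff₀ hθ] at this
            rw [div_mul_eq_mul_div, le_div_iff₀ (by positivity)]
            linarith
          · exact mul_nonneg (by positivity) (Finset.sum_nonneg fun j _ => hφ _)
      _ ≤ _ := by
          rw [← Finset.mul_sum, Finset.sum_comm, Finset.sum_congr rfl h1, Finset.sum_const, hcard,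
            nsmul_eq_mul]
          apply le_of_eq
          field_simp
  · rw [Finset.sum_eq_zero]
    · positivity
    · intro f hf
      rw [(Finset.mem_filter.1 hf).2, if_neg fun h => hk h.1]

end Samples

/-! ### The median algorithm by simplification -/

/-- The chance that no curve drawn for simplification is near the center is at most `δ / 2`. -/
theorem half_pow_median34SampleSize_le {δ : ℝ} (h0 : 0 < δ) (h1 : δ < 1) :
    (1 / 2 : ℝ) ^ median34SampleSize δ ≤ δ / 2 := by
  have hlog : 1 / 2 < Real.log 2 := by linarith [Real.log_two_gt_d9]
  have hδ : Real.log δ < 0 := Real.log_neg h0 h1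
  have hN : 2 * (Real.log 2 - Real.log δ) ≤ (median34SampleSize δ : ℝ) := Nat.le_ceil _
  rw [← Real.log_le_log_iff (by positivity) (by positivity), Real.log_pow,
    Real.log_div h0.ne' two_ne_zero, one_div, Real.log_inv]
  nlinarith

/-- The union bound over all simplified curves for a misjudgement by the evaluation sample. -/
theorem median34SampleSize_mul_exp_le {δ : ℝ} (h0 : 0 < δ) (h1 : δ < 1) :
    median34SampleSize δ * Real.exp (-((median34EvalSize δ : ℝ) / 16)) ≤ δ / 2 := by
  have hlog : 0.69 < Real.log 2 := by linarith [Real.log_two_gt_d9]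
  have hδ : Real.log δ < 0 := Real.log_neg h0 h1
  set M : ℕ := ⌈4 * Real.log 2 - Real.log δ⌉₊ with hM
  have hM1 : 4 * Real.log 2 - Real.log δ ≤ M := Nat.le_ceil _
  have hM2 : (2 : ℝ) ≤ M := by linarith
  have hM0 : (0 : ℝ) < M := by linarith
  have hN1 : (median34SampleSize δ : ℝ) ≤ 2 * M := by
    have := (Nat.ceil_lt_add_one (show 0 ≤ 2 * (Real.log 2 - Real.log δ) by linarith)).le
    rw [median34SampleSize]
    linarith
  have hN2 : -64 * (Real.log δ - Real.log M) ≤ (median34EvalSize δ : ℝ) := Nat.le_ceil _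
  have h2 : Real.exp (-((median34EvalSize δ : ℝ) / 16)) ≤ (δ / M) ^ 4 := by
    rw [← Real.le_log_iff_exp_le (by positivity), Real.log_pow, Real.log_div h0.ne' hM0.ne']
    push_cast
    linarith
  calc _ ≤ 2 * M * (δ / M) ^ 4 := mul_le_mul hN1 h2 (Real.exp_pos _).le (by positivity)
    _ = 2 * δ * (δ / M) ^ 3 := by field_simp
    _ ≤ 2 * δ * (1 / 2) ^ 3 := by
        gcongr
    _ ≤ δ / 2 := by linarith

section Median34

variable {d : ℕ}

theorem sampleCost_eq {ι : Type} [Fintype ι] (A : ι → PolygonalCurve d) (c : PolygonalCurve d) :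
    sampleCost A c = Fintype.card ι * 𝔼 i, frechetDist (A i) c :=
  (Fintype.card_mul_expect _).symm

/-- A center whose average distance is more than 34 times that of `c₀` is unlikely to beat, on an
evaluation sample, a center at distance at most 10 average distances from `c₀`. -/
theorem uniformProb_sampleCost_le_sampleCost_le {ι : Type} [Fintype ι] [Nonempty ι]
    (A : ι → PolygonalCurve d) (c₀ c c' : PolygonalCurve d) (n : ℕ)
    (hc : 34 * (𝔼 i, frechetDist (A i) c₀) < 𝔼 i, frechetDist (A i) c)
    (hc' : frechetDist c₀ c' ≤ 10 * 𝔼 i, frechetDist (A i) c₀) :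
    uniformProb (fun W : Fin n → ι =>
      sampleCost (fun j => A (W j)) c ≤ sampleCost (fun j => A (W j)) c')
      ≤ Real.exp (-((n : ℝ) / 16)) := by
  set μ := 𝔼 i, frechetDist (A i) c₀ with hμ
  have hμ0 : 0 ≤ μ := Finset.expect_nonneg fun i _ => frechetDist_nonneg _ _
  have h1 : (𝔼 i, frechetDist (A i) c') ≤ μ + frechetDist c₀ c' := by
    rw [hμ, ← Fintype.expect_const (ι := ι) (frechetDist c₀ c'), ← Finset.expect_add_distrib]
    exact Finset.expect_le_expect fun i _ => frechetDist_triangle _ _ _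
  have h2 : frechetDist c c' ≤ (𝔼 i, frechetDist (A i) c) + 𝔼 i, frechetDist (A i) c' := by
    rw [← Finset.expect_add_distrib]
    refine Finset.le_expect Finset.univ_nonempty fun i _ => ?_
    rw [frechetDist_comm (A i) c]
    exact frechetDist_triangle _ _ _
  have habs : ∀ i, |frechetDist (A i) c - frechetDist (A i) c'| ≤ frechetDist c c' := fun i => by
    have h3 := frechetDist_triangle (A i) c c'
    have h4 := frechetDist_triangle (A i) c' c
    rw [frechetDist_comm c' c] at h4
    rw [abs_le]
    constructor <;> linarith
  have h3 : (𝔼 i, (frechetDist (A i) c - frechetDist (A i) c'))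
      = (𝔼 i, frechetDist (A i) c) - 𝔼 i, frechetDist (A i) c' := Finset.expect_sub_distrib _ _ _
  have h4 : (𝔼 i, (frechetDist (A i) c - frechetDist (A i) c')) ≤ frechetDist c c' :=
    Finset.expect_le Finset.univ_nonempty fun i _ => (le_abs_self _).trans (habs i)
  refine (uniformProb_mono fun W hW => ?_).trans (uniformProb_sum_nonpos_le n
    (fun i => frechetDist (A i) c - frechetDist (A i) c') (D := frechetDist c c')
    (by linarith) habs (by linarith))
  rw [Finset.sum_sub_distrib]
  exact sub_nonpos.2 hW

/-- With probability at least `1 - δ`, the algorithm returns a center whose cost is at most 34 times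
that of a given center with at most `ℓ` vertices. -/
theorem uniformProb_isMedian34Output_le {ℓ : ℕ} {simpl : PolygonalCurve d → PolygonalCurve d}
    (hsimpl : IsSimplifier 4 ℓ simpl) {ι : Type} [Fintype ι] [Nonempty ι]
    (A : ι → PolygonalCurve d) (c₀ : PolygonalCurve d) (hc₀ : c₀.complexity ≤ ℓ) {δ : ℝ}
    (h0 : 0 < δ) (h1 : δ < 1) :
    uniformProb (fun x : (Fin (median34SampleSize δ) → ι) × (Fin (median34EvalSize δ) → ι) =>
      ∃ c, IsMedian34Output simpl A x.1 x.2 c ∧ 34 * sampleCost A c₀ < sampleCost A c) ≤ δ := by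
  classical
  set μ := 𝔼 i, frechetDist (A i) c₀ with hμ
  have hcard : (0 : ℝ) < Fintype.card ι := by exact_mod_cast Fintype.card_pos
  have hcost : ∀ c, 34 * sampleCost A c₀ < sampleCost A c ↔ 34 * μ < 𝔼 i, frechetDist (A i) c :=
    fun c => by rw [sampleCost_eq, sampleCost_eq, ← hμ, mul_left_comm, mul_lt_mul_iff_right₀ hcard]
  -- All curves drawn for simplification are far from `c₀`, or one of them is close to it.
  calc _ ≤ uniformProb (fun x : (Fin (median34SampleSize δ) → ι) ×
            (Fin (median34EvalSize δ) → ι) => (∀ j, 2 * μ < frechetDist (A (x.1 j)) c₀) ∨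
          ¬ (∀ j, 2 * μ < frechetDist (A (x.1 j)) c₀) ∧ ∃ c, IsMedian34Output simpl A x.1 x.2 c ∧
            34 * sampleCost A c₀ < sampleCost A c) := uniformProb_mono fun x hx => by tauto
    _ ≤ δ / 2 + δ / 2 := (uniformProb_or_le _ _).trans (add_le_add ?_ ?_)
    _ = δ := add_halves δ
  · rw [uniformProb_fst (fun S : Fin (median34SampleSize δ) → ι =>
      ∀ j, 2 * μ < frechetDist (A (S j)) c₀),
      uniformProb_const_pi_forall _ fun i => 2 * μ < frechetDist (A i) c₀]
    refine (pow_le_pow_left₀ (uniformProb_nonneg _) ?_ _).trans (half_pow_median34SampleSize_le h0 h1)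
    exact expect_indicator_mul_expect_lt_le (fun i _ => frechetDist_nonneg (A i) c₀) two_pos hμ
  · refine uniformProb_prod_le fun S => ?_
    by_cases hS : ∀ j, 2 * μ < frechetDist (A (S j)) c₀
    · rw [uniformProb_eq_zero fun W hW => hW.1 hS]
      positivity
    · obtain ⟨j₀, hj₀⟩ := not_forall.1 hS
      rw [not_lt] at hj₀
      have hc' : frechetDist c₀ (simpl (A (S j₀))) ≤ 10 * μ := by
        have h2 := (hsimpl (A (S j₀))).2 c₀ hc₀
        have h3 := frechetDist_triangle c₀ (A (S j₀)) (simpl (A (S j₀)))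
        rw [frechetDist_comm c₀ (A (S j₀))] at h3
        linarith
      refine le_trans (uniformProb_mono (q := fun W => ∃ j : Fin (median34SampleSize δ),
        34 * μ < (𝔼 i, frechetDist (A i) (simpl (A (S j)))) ∧
        sampleCost (fun i => A (W i)) (simpl (A (S j))) ≤
          sampleCost (fun i => A (W i)) (simpl (A (S j₀)))) ?_) ?_
      · rintro W ⟨-, c, ⟨⟨j, rfl⟩, hmin⟩, hbad⟩
        exact ⟨j, (hcost _).1 hbad, hmin j₀⟩
      · refine (uniformProb_exists_le _).trans ?_
        refine le_trans (Finset.sum_le_sum (g := fun _ =>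
          Real.exp (-((median34EvalSize δ : ℝ) / 16))) fun j _ => ?_) ?_
        · by_cases hj : 34 * μ < 𝔼 i, frechetDist (A i) (simpl (A (S j)))
          · exact (uniformProb_mono fun W hW => hW.2).trans
              (uniformProb_sampleCost_le_sampleCost_le A c₀ _ _ _ hj hc')
          · rw [uniformProb_eq_zero fun W hW => hj hW.1]
            positivity
        · simpa using median34SampleSize_mul_exp_le h0 h1

end Median34

/-! ### The candidates -/

section Parameters

variable {β δ ε : ℝ}

theorem lt_log_four : 1.38 < Real.log 4 := by
  rw [show (4 : ℝ) = 2 ^ 2 by norm_num, Real.log_pow]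
  push_cast
  linarith [Real.log_two_gt_d9]

theorem le_shortcutSampleSize_div (δ : ℝ) (hβ : 1 ≤ β) (hε : ε ∈ Set.Ioo (0 : ℝ) 1) :
    12 * (Real.log 4 - Real.log δ) ≤ ε * (shortcutSampleSize β δ ε / (2 * β)) := by
  have hβ0 : 0 < β := by linarith
  have hε0 := hε.1
  have h : -8 * β * (ε / 3)⁻¹ * (Real.log δ - Real.log 4) ≤ (shortcutSampleSize β δ ε : ℝ) :=
    Nat.le_ceil _
  have h2 : -8 * β * (ε / 3)⁻¹ * (Real.log δ - Real.log 4)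
      = 12 * (Real.log 4 - Real.log δ) * (2 * β) / ε := by field_simp; ring
  rw [h2, div_le_iff₀ hε0] at h
  rw [← mul_div_assoc, le_div_iff₀ (by positivity)]
  linarith

theorem shortcutSampleSize_div_le (β δ ε : ℝ) :
    (shortcutSampleSize β δ ε / (2 * β) : ℝ) ≤ shortcutSubsampleSize β δ ε := Nat.le_ceil _

theorem le_mul_shortcutSubsampleSize (δ : ℝ) (hβ : 1 ≤ β) (hε : ε ∈ Set.Ioo (0 : ℝ) 1) :
    12 * (Real.log 4 - Real.log δ) ≤ ε * shortcutSubsampleSize β δ ε :=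
  (le_shortcutSampleSize_div δ hβ hε).trans
    (mul_le_mul_of_nonneg_left (shortcutSampleSize_div_le β δ ε) hε.1.le)

theorem shortcutSubsampleSize_pos (hβ : 1 ≤ β) (hδ : δ ∈ Set.Ioo (0 : ℝ) 1)
    (hε : ε ∈ Set.Ioo (0 : ℝ) 1) : 0 < shortcutSubsampleSize β δ ε := by
  have h := le_mul_shortcutSubsampleSize δ hβ hε
  have h4 := lt_log_four
  have hlogδ := Real.log_neg hδ.1 hδ.2
  rw [Nat.pos_iff_ne_zero]
  intro h0
  rw [h0] at h
  norm_num at h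
  linarith

theorem le_shortcutSampleSize (hβ : 1 ≤ β) (hδ : δ ∈ Set.Ioo (0 : ℝ) 1)
    (hε : ε ∈ Set.Ioo (0 : ℝ) 1) : (30 : ℝ) ≤ shortcutSampleSize β δ ε := by
  have h := le_shortcutSampleSize_div δ hβ hε
  have h4 := lt_log_four
  have hlogδ := Real.log_neg hδ.1 hδ.2
  have h1 : (shortcutSampleSize β δ ε / (2 * β) : ℝ) ≤ shortcutSampleSize β δ ε / 2 := by
    gcongr; linarith
  have h0 : (0 : ℝ) ≤ shortcutSampleSize β δ ε / (2 * β) := by positivity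
  nlinarith [hε.1, hε.2]

theorem shortcutSubsampleSize_le (hβ : 1 ≤ β) (hδ : δ ∈ Set.Ioo (0 : ℝ) 1)
    (hε : ε ∈ Set.Ioo (0 : ℝ) 1) :
    (shortcutSubsampleSize β δ ε : ℝ) ≤ 8 / 15 * shortcutSampleSize β δ ε := by
  have h1 : (shortcutSampleSize β δ ε / (2 * β) : ℝ) ≤ shortcutSampleSize β δ ε / 2 := by
    gcongr; linarith
  have h2 : (shortcutSubsampleSize β δ ε : ℝ) ≤ shortcutSampleSize β δ ε / (2 * β) + 1 :=
    (Nat.ceil_lt_add_one (by positivity)).le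
  have := le_shortcutSampleSize hβ hδ hε
  linarith

theorem exp_neg_shortcutSampleSize_le (hβ : 1 ≤ β) (hδ : δ ∈ Set.Ioo (0 : ℝ) 1)
    (hε : ε ∈ Set.Ioo (0 : ℝ) 1) :
    Real.exp (-((shortcutSampleSize β δ ε / (2 * β) : ℝ) / 4)) ≤ δ / 64 := by
  have h := le_shortcutSampleSize_div δ hβ hε
  have h4 := lt_log_four
  have hlogδ := Real.log_neg hδ.1 hδ.2
  have h0 : (0 : ℝ) ≤ shortcutSampleSize β δ ε / (2 * β) := by positivity
  have hδ0 := hδ.1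
  rw [← Real.le_log_iff_exp_le (by positivity), Real.log_div hδ0.ne' (by norm_num),
    show (64 : ℝ) = 4 ^ 3 by norm_num, Real.log_pow]
  push_cast
  nlinarith [hε.1, hε.2]

theorem one_div_pow_shortcutSubsampleSize_le (hβ : 1 ≤ β) (hδ : δ ∈ Set.Ioo (0 : ℝ) 1)
    (hε : ε ∈ Set.Ioo (0 : ℝ) 1) :
    (1 / (1 + ε / 3)) ^ shortcutSubsampleSize β δ ε ≤ δ / 16 := by
  have h := le_mul_shortcutSubsampleSize δ hβ hε
  have h4 := lt_log_four
  have hlogδ := Real.log_neg hδ.1 hδ.2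
  have hδ0 := hδ.1
  have hε0 := hε.1
  have hε1 := hε.2
  have hlog : ε / 4 ≤ Real.log (1 + ε / 3) := by
    refine le_trans ?_ (Real.one_sub_inv_le_log_of_pos (by positivity))
    rw [← one_div, le_sub_iff_add_le, ← le_sub_iff_add_le', div_le_iff₀ (by positivity)]
    nlinarith
  rw [← Real.log_le_log_iff (by positivity) (by positivity), Real.log_pow,
    Real.log_div hδ0.ne' (by norm_num), show (16 : ℝ) = 4 ^ 2 by norm_num, Real.log_pow, one_div,
    Real.log_inv]
  push_cast
  nlinarith [(Nat.cast_nonneg _ : (0 : ℝ) ≤ shortcutSubsampleSize β δ ε)]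

end Parameters

section Candidates

variable {d : ℕ}

theorem norm_sub_gridPoint_le {r : ℝ} (hr : 0 < r) (p : EuclideanSpace ℝ (Fin d)) :
    ‖p - gridPoint r p‖ ≤ √(d : ℝ) * r := by
  rw [EuclideanSpace.norm_eq]
  have h : ∀ i, ‖(p - gridPoint r p) i‖ ^ 2 ≤ r ^ 2 := fun i => by
    have h1 : (p - gridPoint r p) i = p i - ⌊p i / r⌋ * r := rfl
    have h2 := (le_div_iff₀ hr).1 (Int.floor_le (p i / r))
    have h3 := (div_lt_iff₀ hr).1 (Int.lt_floor_add_one (p i / r))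
    rw [h1, Real.norm_of_nonneg (by linarith)]
    exact pow_le_pow_left₀ (by linarith) (by linarith) 2
  refine (Real.sqrt_le_sqrt (Finset.sum_le_sum fun i _ => h i)).trans ?_
  rw [Finset.sum_const, Finset.card_univ, Fintype.card_fin, nsmul_eq_mul,
    Real.sqrt_mul (Nat.cast_nonneg d), Real.sqrt_sq hr.le]

theorem cost_le_cost_add (T : Finset (PolygonalCurve d)) (c c' : PolygonalCurve d) :
    cost T c' ≤ cost T c + T.card * frechetDist c c' := by
  rw [cost, cost, ← nsmul_eq_mul, ← Finset.sum_const, ← Finset.sum_add_distrib]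
  exact Finset.sum_le_sum fun τ _ => frechetDist_triangle _ _ _

theorem cost_nonneg (T : Finset (PolygonalCurve d)) (c : PolygonalCurve d) : 0 ≤ cost T c :=
  Finset.sum_nonneg fun _ _ => frechetDist_nonneg _ _

theorem pos_of_frechetDist_pos {γ τ : PolygonalCurve d} (h : 0 < frechetDist γ τ) : 0 < d := by
  rw [Nat.pos_iff_ne_zero]
  rintro rfl
  refine h.not_ge (curveFrechetDist_le default fun t => ?_)
  rw [Subsingleton.elim (γ.toCurve t - _) 0, norm_zero]

/-- Let `μ` be the average distance of the curves in `T'` to a center `c₀`. If the subsample at `J`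
contains a curve `s` at distance at most `(1 + ε / 3) μ` from `c₀`, the cost of `c₀` for it does not
exceed its expectation much, and `c J` is a 34-approximate median for it, then there is a good
candidate: either `c J` is close to `c₀`, or `s` is far from `c J` and therefore the grids around the
vertices of `s` cover the vertices of the curve obtained by shortcutting `c₀` along `s`. -/
theorem ShortcutRandomness.exists_mem_candidates {ℓ : ℕ} (hℓ : 2 ≤ ℓ) {β δ ε : ℝ} (hβ : 1 ≤ β)
    (hδ : δ ∈ Set.Ioo (0 : ℝ) 1) (hε : ε ∈ Set.Ioo (0 : ℝ) 1) {T T' : Finset (PolygonalCurve d)}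
    (hT : T.Nonempty) (ω : ShortcutRandomness T β δ ε) (c : Subsample β δ ε → PolygonalCurve d)
    (J : Subsample β δ ε) (hcJ : (c J).complexity ≤ ℓ) {c₀ : PolygonalCurve d}
    (hc₀ : c₀.complexity ≤ ℓ) {μ : ℝ} (hμ : 0 < μ) (hcost : cost T' c₀ = T'.card * μ)
    (hs : ∃ j, frechetDist (ω.subsample J j) c₀ ≤ (1 + ε / 3) * μ)
    (hΔ : ω.Δ J (c J) ≤ 34 * sampleCost (ω.subsample J) c₀)
    (hJ : sampleCost (ω.subsample J) c₀ ≤ shortcutSubsampleSize β δ ε * μ / (13 / 20 * δ)) :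
    ∃ q ∈ ω.candidates ℓ c, q.complexity ≤ 2 * ℓ - 2 ∧
      cost T' q ≤ (3 + 29 / 30 * ε) * cost T' c₀ := by
  obtain ⟨j, hj⟩ := hs
  have hδ0 := hδ.1
  have hε0 := hε.1
  have hε1 := hε.2
  have hεμ : 0 < ε * μ := mul_pos hε0 hμ
  by_cases hfar : frechetDist c₀ (c J) ≤ (2 + 29 / 30 * ε) * μ
  · refine ⟨c J, Set.mem_iUnion.2 ⟨J, Or.inl rfl⟩, by omega, ?_⟩
    have h1 := cost_le_cost_add T' c₀ (c J)
    have h2 : T'.card * frechetDist c₀ (c J) ≤ T'.card * ((2 + 29 / 30 * ε) * μ) := by gcongr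
    rw [hcost] at h1 ⊢
    linarith
  rw [not_le] at hfar
  set s := ω.subsample J j with hs
  have hsc : μ < frechetDist s (c J) := by
    have h1 := frechetDist_triangle c₀ s (c J)
    rw [frechetDist_comm c₀ s] at h1
    linarith
  have hΔμ : μ < ω.Δ J (c J) := hsc.trans_le
    (Finset.single_le_sum (f := fun i => frechetDist (ω.subsample J i) (c J))
      (fun i _ => frechetDist_nonneg _ _) (Finset.mem_univ j))
  have hΔ0 : 0 < ω.Δ J (c J) := hμ.trans hΔμ
  -- For `d = 0` the grid width is a quotient by zero, but then all Fréchet distances vanish.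
  have hd : (0 : ℝ) < d := by exact_mod_cast pos_of_frechetDist_pos (hμ.trans hsc)
  have hn : (0 : ℝ) < T.card := by exact_mod_cast hT.card_pos
  have hN : (0 : ℝ) < shortcutSampleSize β δ ε := by linarith [le_shortcutSampleSize hβ hδ hε]
  obtain ⟨v, hv, hvs⟩ := exists_shortcut hℓ c₀ s hc₀ (r := (1 + 17 / 50 * ε) * μ)
    (by rw [frechetDist_comm]; linarith)
  have hr0 : frechetDist c₀ s ≤ (1 + 17 / 50 * ε) * μ := by rw [frechetDist_comm]; linarith
  set w : ℝ := 2 * (ε / 3) / (T.card * √(d : ℝ)) * ω.Δl J (c J) with hw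
  have hΔl : ω.Δl J (c J) = δ * T.card / (2 * shortcutSampleSize β δ ε) * (ω.Δ J (c J) / 34) := rfl
  have hw0 : 0 < w := by
    rw [hw, hΔl]; positivity
  -- Here the factor `δ` in `Δ_l` cancels the factor `1 / δ` in the bound on the cost of `c₀`.
  have hround : √(d : ℝ) * w ≤ 5 / 6 * (ε / 3) * μ := by
    have h1 : √(d : ℝ) * w
        = ε / 3 * δ * ω.Δ J (c J) / (34 * shortcutSampleSize β δ ε) := by
      rw [hw, hΔl]; field_simp
    have h2 : ω.Δ J (c J) ≤ 34 * (8 / 15 * shortcutSampleSize β δ ε * μ / (13 / 20 * δ)) := by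
      refine hΔ.trans (mul_le_mul_of_nonneg_left (hJ.trans ?_) (by norm_num))
      gcongr
      exact shortcutSubsampleSize_le hβ hδ hε
    rw [h1, div_le_iff₀ (by positivity)]
    calc _ ≤ ε / 3 * δ * (34 * (8 / 15 * shortcutSampleSize β δ ε * μ / (13 / 20 * δ))) := by gcongr
      _ = 32 / 39 * (ε / 3) * μ * (34 * shortcutSampleSize β δ ε) := by field_simp; norm_num
      _ ≤ _ := by nlinarith [mul_pos hεμ hN]
  let q : PolygonalCurve d := ⟨2 * ℓ - 3, by omega, fun i => gridPoint w (v i)⟩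
  have hq : q.complexity = 2 * ℓ - 2 := by
    change 2 * ℓ - 3 + 1 = _
    omega
  refine ⟨q, Set.mem_iUnion.2 ⟨J, Or.inr (Set.mem_iUnion.2 ⟨j, hq, fun i => ?_⟩)⟩, hq.le, ?_⟩
  · obtain ⟨i', hi'⟩ := hv i
    refine Set.mem_iUnion.2 ⟨i', hw0, v i, ?_, rfl⟩
    rw [mem_closedBall_iff_norm]
    refine hi'.trans ?_
    have h1 : ω.Δu J (c J) = 3 * ω.Δ J (c J) / ε := by
      rw [ShortcutRandomness.Δu]; field_simp
    have h2 : 3 * μ ≤ ω.Δu J (c J) := by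
      rw [h1, le_div_iff₀ hε0]; nlinarith
    nlinarith
  · have h1 := cost_le_cost_add T' c₀ q
    have h2 := frechetDist_triangle c₀ s q
    have h3 := frechetDist_triangle s ⟨2 * ℓ - 3, by omega, v⟩ q
    have h4 : frechetDist ⟨2 * ℓ - 3, by omega, v⟩ q ≤ √(d : ℝ) * w :=
      frechetDist_le_of_vertex _ _ _ fun i => norm_sub_gridPoint_le hw0 (v i)
    rw [frechetDist_comm] at hvs
    have h5 : frechetDist c₀ q ≤ (2 + 29 / 30 * ε) * μ := by
      have : 5 / 6 * (ε / 3) * μ = 5 / 18 * (ε * μ) := by ring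
      linarith
    have h6 : T'.card * frechetDist c₀ q ≤ T'.card * ((2 + 29 / 30 * ε) * μ) := by gcongr
    rw [hcost] at h1 ⊢
    linarith

/-- If some centers with at most `ℓ` vertices have arbitrarily small cost, then the simplifications
of the curves in `T'` have cost zero. -/
theorem cost_simpl_eq_zero {ℓ : ℕ} {simpl : PolygonalCurve d → PolygonalCurve d}
    (hsimpl : IsSimplifier 4 ℓ simpl) {T' : Finset (PolygonalCurve d)}
    (h : ∀ η > 0, ∃ c' : PolygonalCurve d, c'.complexity ≤ ℓ ∧ cost T' c' < η)
    {s : PolygonalCurve d} (hs : s ∈ T') : cost T' (simpl s) = 0 := by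
  refine Finset.sum_eq_zero fun τ hτ => le_antisymm ?_ (frechetDist_nonneg _ _)
  refine le_of_forall_pos_le_add fun η hη => ?_
  obtain ⟨c', hc', hlt⟩ := h (η / 6) (by positivity)
  have h1 : ∀ τ ∈ T', frechetDist τ c' ≤ η / 6 := fun τ hτ =>
    (Finset.single_le_sum (f := fun τ => frechetDist τ c') (fun _ _ => frechetDist_nonneg _ _)
      hτ).trans hlt.le
  have h2 := (hsimpl s).2 c' hc'
  have h3 := frechetDist_triangle τ c' (simpl s)
  have h4 := frechetDist_triangle c' s (simpl s)
  rw [frechetDist_comm c' s] at h4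
  linarith [h1 τ hτ, h1 s hs]

end Candidates

/-! ### The success probability -/

section Randomness

variable {d : ℕ} {T : Finset (PolygonalCurve d)} {β δ ε : ℝ}

/-- The random choices of a run are the sample `S` and, independently for each subsample, the pair of
samples drawn in the call of the simplification algorithm. -/
noncomputable def ShortcutRandomness.equivProd (T : Finset (PolygonalCurve d)) (β δ ε : ℝ) :
    ShortcutRandomness T β δ ε ≃ (Fin (shortcutSampleSize β δ ε) → T) ×
      (∀ J : Subsample β δ ε, (Fin (median34SampleSize (δ / 4)) → J.1) ×
        (Fin (median34EvalSize (δ / 4)) → J.1)) where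
  toFun ω := (ω.S, fun J => (ω.S₁ J, ω.W J))
  invFun x := ⟨x.1, fun J => (x.2 J).1, fun J => (x.2 J).2⟩
  left_inv _ := rfl
  right_inv _ := rfl

noncomputable instance : Fintype (ShortcutRandomness T β δ ε) :=
  Fintype.ofEquiv _ (ShortcutRandomness.equivProd T β δ ε).symm

instance : DiscreteMeasurableSpace (ShortcutRandomness T β δ ε) := ⟨fun _ => trivial⟩

theorem Subsample.nonempty (hβ : 1 ≤ β) (hδ : δ ∈ Set.Ioo (0 : ℝ) 1) (hε : ε ∈ Set.Ioo (0 : ℝ) 1)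
    (J : Subsample β δ ε) : Nonempty J.1 := by
  have := shortcutSubsampleSize_pos hβ hδ hε
  rw [← J.2] at this
  exact (Finset.card_pos.1 this).to_subtype

theorem ShortcutRandomness.nonempty (hβ : 1 ≤ β) (hδ : δ ∈ Set.Ioo (0 : ℝ) 1)
    (hε : ε ∈ Set.Ioo (0 : ℝ) 1) (hT : T.Nonempty) : Nonempty (ShortcutRandomness T β δ ε) := by
  have := hT.to_subtype
  have := Subsample.nonempty hβ hδ hε
  exact ⟨⟨fun _ => Classical.arbitrary _, fun _ _ => Classical.arbitrary _,
    fun _ _ => Classical.arbitrary _⟩⟩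

theorem uniformProb_sample (hβ : 1 ≤ β) (hδ : δ ∈ Set.Ioo (0 : ℝ) 1) (hε : ε ∈ Set.Ioo (0 : ℝ) 1)
    (p : (Fin (shortcutSampleSize β δ ε) → T) → Prop) :
    uniformProb (fun ω : ShortcutRandomness T β δ ε => p ω.S) = uniformProb p := by
  have := Subsample.nonempty hβ hδ hε
  rw [← uniformProb_equiv (ShortcutRandomness.equivProd T β δ ε).symm]
  exact uniformProb_fst p

/-- The call of the simplification algorithm on a subsample chosen by looking at the sample `S`
is as reliable as on a fixed input, because it uses fresh randomness. -/
theorem uniformProb_call_le (hβ : 1 ≤ β) (hδ : δ ∈ Set.Ioo (0 : ℝ) 1) (hε : ε ∈ Set.Ioo (0 : ℝ) 1)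
    (hT : T.Nonempty) {ℓ : ℕ} {simpl : PolygonalCurve d → PolygonalCurve d}
    (hsimpl : IsSimplifier 4 ℓ simpl) {c₀ : PolygonalCurve d} (hc₀ : c₀.complexity ≤ ℓ)
    (p : (Fin (shortcutSampleSize β δ ε) → T) → Prop) (J : ∀ S, p S → Subsample β δ ε) :
    uniformProb (fun ω : ShortcutRandomness T β δ ε => ∃ h : p ω.S, ∃ c,
      IsMedian34Output simpl (ω.subsample (J ω.S h)) (ω.S₁ (J ω.S h)) (ω.W (J ω.S h)) c ∧
        34 * sampleCost (ω.subsample (J ω.S h)) c₀ < ω.Δ (J ω.S h) c) ≤ δ / 4 := by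
  have hne := Subsample.nonempty hβ hδ hε
  have := hT.to_subtype
  have hδ0 := hδ.1
  rw [← uniformProb_equiv (ShortcutRandomness.equivProd T β δ ε).symm]
  refine uniformProb_prod_le fun S => ?_
  by_cases h : p S
  · refine le_trans (le_of_eq ?_) (uniformProb_isMedian34Output_le hsimpl
      (fun i : (J S h).1 => (S i.1).1) c₀ hc₀ (δ := δ / 4) (by linarith) (by linarith [hδ.2]))
    rw [← uniformProb_pi_eval (X := fun J : Subsample β δ ε =>
      (Fin (median34SampleSize (δ / 4)) → J.1) × (Fin (median34EvalSize (δ / 4)) → J.1)) (J S h)]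
    refine congrArg uniformProb (funext fun f => propext ?_)
    exact ⟨fun ⟨_, hc⟩ => hc, fun hc => ⟨h, hc⟩⟩
  · rw [uniformProb_eq_zero fun f hf => h hf.1]
    linarith

end Randomness

section Assembly

variable {d : ℕ} {β δ ε : ℝ}

/-- A set of `k` of the positions in `H` if there are that many, and the empty set otherwise. -/
noncomputable def chooseSubset {n : ℕ} (k : ℕ) (H : Finset (Fin n)) : Finset (Fin n) :=
  if h : k ≤ H.card then (Finset.exists_subset_card_eq h).choose else ∅

theorem chooseSubset_spec {n k : ℕ} {H : Finset (Fin n)} (h : k ≤ H.card) :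
    chooseSubset k H ⊆ H ∧ (chooseSubset k H).card = k := by
  rw [chooseSubset, dif_pos h]
  exact (Finset.exists_subset_card_eq h).choose_spec

open Classical in
/-- The sample contains a full subsample of curves of `T'` with high probability. -/
theorem uniformProb_card_hits_lt_shortcutSubsampleSize_le (hβ : 1 ≤ β) (hδ : δ ∈ Set.Ioo (0 : ℝ) 1)
    (hε : ε ∈ Set.Ioo (0 : ℝ) 1) {T T' : Finset (PolygonalCurve d)} (hT : T.Nonempty)
    (hT' : T' ⊆ T) (hcard : (1 / β) * (T.card : ℝ) ≤ T'.card) :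
    uniformProb (fun S : Fin (shortcutSampleSize β δ ε) → T =>
      (hits (T'.subtype (· ∈ T)) S).card < shortcutSubsampleSize β δ ε) ≤ δ / 64 := by
  have := hT.to_subtype
  have hn : (0 : ℝ) < T.card := by exact_mod_cast hT.card_pos
  have hβ0 : 0 < β := by linarith
  refine le_trans (uniformProb_mono fun S hS => ?_) ((uniformProb_card_hits_lt_le
    (T'.subtype (· ∈ T)) (x := shortcutSampleSize β δ ε / (2 * β)) (by positivity) ?_).trans
      (exp_neg_shortcutSampleSize_le hβ hδ hε))
  · exact Nat.lt_ceil.1 hS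
  · rw [Finset.card_subtype, Finset.filter_true_of_mem hT', Fintype.card_coe]
    have h1 : 1 / β ≤ (T'.card : ℝ) / T.card := by rwa [le_div_iff₀ hn]
    calc 2 * (shortcutSampleSize β δ ε / (2 * β) : ℝ) = shortcutSampleSize β δ ε * (1 / β) := by
          field_simp
      _ ≤ _ := by gcongr

theorem expect_subtype_frechetDist {T T' : Finset (PolygonalCurve d)} (hT' : T' ⊆ T)
    (c : PolygonalCurve d) [DecidablePred (· ∈ T)] :
    (𝔼 x ∈ T'.subtype (· ∈ T), frechetDist x.1 c) = cost T' c / T'.card := by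
  rw [Finset.expect_eq_sum_div_card, Finset.card_subtype, Finset.filter_true_of_mem hT', cost,
    Finset.sum_subtype_of_mem (fun x => frechetDist x c) hT']

open Classical in
/-- The case of a center `c₀` of positive cost: some candidate costs at most about 3 times as much,
with high probability. -/
theorem uniformProb_not_exists_candidate_le {ℓ : ℕ} (hℓ : 2 ≤ ℓ) (hβ : 1 ≤ β)
    (hδ : δ ∈ Set.Ioo (0 : ℝ) 1) (hε : ε ∈ Set.Ioo (0 : ℝ) 1)
    {simpl : PolygonalCurve d → PolygonalCurve d} (hsimpl : IsSimplifier 4 ℓ simpl)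
    {T T' : Finset (PolygonalCurve d)} (hT : T.Nonempty) (hT' : T' ⊆ T)
    (hcard : (1 / β) * (T.card : ℝ) ≤ T'.card) {c₀ : PolygonalCurve d} (hc₀ : c₀.complexity ≤ ℓ)
    (hpos : 0 < cost T' c₀) :
    uniformProb (fun ω : ShortcutRandomness T β δ ε => ¬ ∀ c, ω.IsCallResult simpl c →
      ∃ q ∈ ω.candidates ℓ c, q.complexity ≤ 2 * ℓ - 2 ∧
        cost T' q ≤ (3 + 29 / 30 * ε) * cost T' c₀) ≤ δ := by
  have := hT.to_subtype
  have hδ0 := hδ.1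
  have hε0 := hε.1
  have hn : (0 : ℝ) < T.card := by exact_mod_cast hT.card_pos
  have hn' : (0 : ℝ) < T'.card := by
    have hβ0 : 0 < β := by linarith
    exact lt_of_lt_of_le (by positivity) hcard
  set A := T'.subtype (· ∈ T) with hA
  set K := shortcutSubsampleSize β δ ε with hK
  have hK0 : 0 < K := shortcutSubsampleSize_pos hβ hδ hε
  set φ : T → ℝ := fun x => frechetDist x.1 c₀ with hφ
  have hφ0 : ∀ x, 0 ≤ φ x := fun x => frechetDist_nonneg _ _
  set μ := 𝔼 x ∈ A, φ x with hμ
  have hμ' : μ = cost T' c₀ / T'.card := expect_subtype_frechetDist hT' c₀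
  have hμ0 : 0 < μ := by rw [hμ']; positivity
  have hcost : cost T' c₀ = T'.card * μ := by rw [hμ']; field_simp
  have hspec : ∀ H : Finset (Fin (shortcutSampleSize β δ ε)), K ≤ H.card →
      chooseSubset K H ⊆ H ∧ (chooseSubset K H).card = K := fun H => chooseSubset_spec
  let J : ∀ S : Fin (shortcutSampleSize β δ ε) → T, K ≤ (hits A S).card → Subsample β δ ε :=
    fun S h => ⟨chooseSubset K (hits A S), (chooseSubset_spec h).2⟩
  -- `E₁`, …, `E₄`: too few hits; no near curve in the subsample; the cost of `c₀` for it is too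
  -- large; the call on it fails. The bounds `δ / 64 + δ / 16 + 13 / 20 * δ + δ / 4` add up to less
  -- than `δ`.
  let E₁ : (Fin (shortcutSampleSize β δ ε) → T) → Prop := fun S => (hits A S).card < K
  let E₂ : (Fin (shortcutSampleSize β δ ε) → T) → Prop := fun S =>
    K ≤ (hits A S).card ∧ ∀ j ∈ chooseSubset K (hits A S), (1 + ε / 3) * μ < φ (S j)
  let E₃ : (Fin (shortcutSampleSize β δ ε) → T) → Prop := fun S =>
    K ≤ (hits A S).card ∧ K * μ / (13 / 20 * δ) < ∑ j ∈ chooseSubset K (hits A S), φ (S j)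
  let E₄ : ShortcutRandomness T β δ ε → Prop := fun ω => ∃ h : K ≤ (hits A ω.S).card, ∃ c,
    IsMedian34Output simpl (ω.subsample (J ω.S h)) (ω.S₁ (J ω.S h)) (ω.W (J ω.S h)) c ∧
      34 * sampleCost (ω.subsample (J ω.S h)) c₀ < ω.Δ (J ω.S h) c
  have hE₁ : uniformProb E₁ ≤ δ / 64 :=
    uniformProb_card_hits_lt_shortcutSubsampleSize_le hβ hδ hε hT hT' hcard
  have hE₂ : uniformProb E₂ ≤ δ / 16 :=
    (uniformProb_forall_mem_le A (chooseSubset K) hspec (fun x => (1 + ε / 3) * μ < φ x)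
      (expect_indicator_mul_expect_lt_le (fun x _ => hφ0 x) (by positivity) hμ)).trans
      (one_div_pow_shortcutSubsampleSize_le hβ hδ hε)
  have hE₃ : uniformProb E₃ ≤ 13 / 20 * δ :=
    uniformProb_lt_sum_mem_le A (chooseSubset K) hK0 hspec φ hφ0 hμ0 (by positivity)
  have hE₄ : uniformProb E₄ ≤ δ / 4 := uniformProb_call_le hβ hδ hε hT hsimpl hc₀ _ J
  refine le_trans (uniformProb_mono (q := fun ω => E₁ ω.S ∨ E₂ ω.S ∨ E₃ ω.S ∨ E₄ ω)
    fun ω hω => ?_) ?_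
  · by_contra hnot
    simp only [not_or] at hnot
    obtain ⟨h₁, h₂, h₃, h₄⟩ := hnot
    have h : K ≤ (hits A ω.S).card := not_lt.1 h₁
    refine hω fun c hc => ?_
    obtain ⟨⟨i, hi⟩, -⟩ := hc (J ω.S h)
    refine ω.exists_mem_candidates hℓ hβ hδ hε hT c (J ω.S h) (hi ▸ (hsimpl _).1) hc₀ hμ0 hcost
      ?_ ?_ ?_
    · by_contra! hfar
      exact h₂ ⟨h, fun j hj => hfar ⟨j, hj⟩⟩
    · by_contra! hbad
      exact h₄ ⟨h, c (J ω.S h), hc _, hbad⟩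
    · by_contra! hbad
      refine h₃ ⟨h, hbad.trans_eq ?_⟩
      exact Finset.sum_coe_sort (chooseSubset K (hits A ω.S)) (fun j => φ (ω.S j))
  · have g₁ := uniformProb_or_le (Ω := ShortcutRandomness T β δ ε) (fun ω => E₁ ω.S)
      (fun ω => E₂ ω.S ∨ E₃ ω.S ∨ E₄ ω)
    have g₂ := uniformProb_or_le (Ω := ShortcutRandomness T β δ ε) (fun ω => E₂ ω.S)
      (fun ω => E₃ ω.S ∨ E₄ ω)
    have g₃ := uniformProb_or_le (Ω := ShortcutRandomness T β δ ε) (fun ω => E₃ ω.S) E₄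
    rw [uniformProb_sample hβ hδ hε E₁] at g₁
    rw [uniformProb_sample hβ hδ hε E₂] at g₂
    rw [uniformProb_sample hβ hδ hε E₃] at g₃
    change uniformProb (fun ω => E₃ ω.S ∨ E₄ ω) ≤ _ at g₃
    linarith

end Assembly

theorem mainTheorem6 (d m ℓ : ℕ) (hℓ : 2 ≤ ℓ) (β δ ε : ℝ) (hβ : 1 ≤ β)
    (hδ : δ ∈ Set.Ioo (0 : ℝ) 1) (hε : ε ∈ Set.Ioo (0 : ℝ) 1)
    (simpl : PolygonalCurve d → PolygonalCurve d) (hsimpl : IsSimplifier 4 ℓ simpl)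
    (T : Finset (PolygonalCurve d)) (hT : T.Nonempty) (hTm : ∀ τ ∈ T, τ.complexity ≤ m)
    (T' : Finset (PolygonalCurve d)) (hT' : T' ⊆ T) (hcard : (1 / β) * (T.card : ℝ) ≤ T'.card) :
    1 - δ ≤ (uniformOn (Set.univ : Set (ShortcutRandomness T β δ ε))).real
      {ω | ∀ c, ω.IsCallResult simpl c →
        ∃ q ∈ ω.candidates ℓ c, q.complexity ≤ 2 * ℓ - 2 ∧ IsApproxMedian (3 + ε) ℓ T' q} := by
  classical
  have hδ0 := hδ.1
  have hε0 := hε.1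
  have := ShortcutRandomness.nonempty hβ hδ hε hT
  rw [uniformOn_univ_real, sub_le_sub_iff_left]
  by_cases hzero : ∀ η > 0, ∃ c' : PolygonalCurve d, c'.complexity ≤ ℓ ∧ cost T' c' < η
  · -- If the infimum of the costs is zero, any simplification of a curve of `T'` has cost zero.
    refine le_trans (uniformProb_mono (q := fun ω => (hits (T'.subtype (· ∈ T)) ω.S).card <
      shortcutSubsampleSize β δ ε) fun ω hω => ?_) ?_
    · by_contra! h
      refine hω fun c hc => ?_
      let J : Subsample β δ ε := ⟨_, (chooseSubset_spec h).2⟩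
      obtain ⟨⟨i, hi⟩, -⟩ := hc J
      have hmem : ω.subsample J (ω.S₁ J i) ∈ T' := by
        have h1 := (chooseSubset_spec h).1 (ω.S₁ J i).2
        rw [hits, Finset.mem_filter, Finset.mem_subtype] at h1
        exact h1.2
      have hcomp : (c J).complexity ≤ ℓ := hi ▸ (hsimpl _).1
      refine ⟨c J, Set.mem_iUnion.2 ⟨J, Or.inl rfl⟩, by omega, fun c' _ => ?_⟩
      rw [hi, cost_simpl_eq_zero hsimpl hzero hmem]
      exact mul_nonneg (by linarith) (cost_nonneg _ _)
    · rw [uniformProb_sample hβ hδ hε (fun S => (hits (T'.subtype (· ∈ T)) S).card <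
        shortcutSubsampleSize β δ ε)]
      have := uniformProb_card_hits_lt_shortcutSubsampleSize_le hβ hδ hε hT hT' hcard
      linarith
  · -- Otherwise the slack in the approximation factor allows for a nearly optimal center.
    push Not at hzero
    obtain ⟨η, hη, hlow⟩ := hzero
    obtain ⟨τ, hτ⟩ := hT
    let c : {c' : PolygonalCurve d // c'.complexity ≤ ℓ} → ℝ := fun c' => cost T' c'.1
    have : Nonempty {c' : PolygonalCurve d // c'.complexity ≤ ℓ} := ⟨⟨_, (hsimpl τ).1⟩⟩
    have hbdd : BddBelow (Set.range c) := ⟨0, by rintro _ ⟨c', rfl⟩; exact cost_nonneg _ _⟩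
    have hopt : 0 < ⨅ c', c c' := hη.trans_le (le_ciInf fun c' => hlow c'.1 c'.2)
    obtain ⟨⟨c₀, hc₀⟩, hlt⟩ := exists_lt_of_ciInf_lt (f := c)
      (a := (3 + ε) / (3 + 29 / 30 * ε) * ⨅ c', c c')
      (lt_mul_of_one_lt_left hopt (by rw [one_lt_div (by positivity)]; linarith))
    refine (uniformProb_mono fun ω hω hex => hω fun c' hc' => ?_).trans
      (uniformProb_not_exists_candidate_le hℓ hβ hδ hε hsimpl ⟨τ, hτ⟩ hT' hcard hc₀
        (hη.trans_le (hlow c₀ hc₀)))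
    obtain ⟨q, hq, hqc, hle⟩ := hex c' hc'
    refine ⟨q, hq, hqc, fun c'' hc'' => hle.trans ?_⟩
    have h1 : (⨅ c', c c') ≤ cost T' c'' := ciInf_le hbdd ⟨c'', hc''⟩
    have h2 : cost T' c₀ < (3 + ε) / (3 + 29 / 30 * ε) * ⨅ c', c c' := hlt
    calc (3 + 29 / 30 * ε) * cost T' c₀
        ≤ (3 + 29 / 30 * ε) * ((3 + ε) / (3 + 29 / 30 * ε) * ⨅ c', c c') := by gcongr
      _ = (3 + ε) * ⨅ c', c c' := by field_simp
      _ ≤ (3 + ε) * cost T' c'' := by gcongr
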